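/- Let $N\ge 1$ and $d\ge 0$ be integers with $d\ge 2$ or $N\le 2$, and with $(N,d)\ne(3,2)$. Let $T^N(\mathbb R^d)=\bigoplus_{k=0}^N(\mathbb R^d)^{\otimes k}$ be the truncated tensor algebra with bracket $[x,y]=x\otimes y-y\otimes x$, and let $\mathfrak g_N=\mathfrak g_N(\mathbb R^d)$ be the free $N$-step nilpotent Lie algebra, realized as the Lie subalgebra of $T^N(\mathbb R^d)$ generated by $\mathbb R^d$. Its layers are $L_1=\mathbb R^d$ and $L_{k+1}=\operatorname{span}[L_1,L_k]$. Let $$X_1^N,\dots,X_{m_N}^N,\;X_1^{N-1},\dots,X_{m_{N-1}}^{N-1},\;\dots,\;X_1^1,\dots,X_{m_1}^1$$ (in this order) be a strong Malcev basis of $\mathfrak g_N$ (the span of each initial segment is a subalgebra and an ideal) such that $X_1^k,\dots,X_{m_k}^k$ is a basis of $L_k$ for each $k\in\{1,\dots,N\}$, and let $(\ell_i^k)$ be the dual basis of $\mathfrak g_N^*$. For $\ell\in\mathfrak g_N^*$ let $\mathcal O_\ell=\{\ell\circ \mathrm{Ad}(\exp(-X)) : X\in\mathfrak g_N\}$ be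 its coadjoint orbit, where $\mathrm{Ad}(\exp X)=\sum_{k\ge0}\frac1{k!}(\operatorname{ad}X)^k$. For an index $(s,n)$ with $1\le s\le N$, $1\le n\le m_s$, let $\mathfrak g_N^*(s,n)$ be the span of the dual basis vectors that come after $\ell_n^s$ in the above order, so that $\mathfrak g_N^*/\mathfrak g_N^*(s,n)\cong\operatorname{span}\{\ell_1^N,\dots,\ell_n^s\}$, and let $\dim(\mathcal O_\ell/\mathfrak g_N^*(s,n))$ be the dimension of the image of $\mathcal O_\ell$ in this quotient. The orbit has maximal dimension at $(s,n)$ if this number is at least the corresponding one for every $\ell'\in\mathfrak g_N^*$, and $\ell$ is in general position if its orbit has maximal dimension at every index $(s,n)$. For $1\le k\le N-1$ and $1\le n\le m_{N-k}$ let $B_\ell^k(n)=\big(\ell([X_i^k,X_j^{N-k}])\big)_{1\le i\le m_k,\,1\le j\le n}$, and for $n>m_{N-k}$ extend the notation by adding zero columns (which does not affect ranks). Let $B_\ell^k=B_\ell^k(m_k)$, a square matrix, and $\dim(k,n)=\max_{\ell'\in\mathfrak g_N^*}\operatorname{rank}B_{\ell'}^k(n)$. Then for every $\ell\in\mathfrak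 g_N^*$ the following are equivalent. (i) $\ell$ is in general position; equivalently, $\mathcal O_\ell$ has maximal dimension at $(N-k,n)$ for all $1\le k\le N-1$ and $1\le n\le m_{N-k}$. (ii) For all $1\le k\le N-1$ and $1\le n\le m_{N-k}$, the rank of $B_\ell^k(n)$ is maximal among all functionals in $\mathfrak g_N^*$. (iii) For all $1\le k\le\lfloor N/2\rfloor$, the rank of $B_\ell^k$ is maximal among all functionals in $\mathfrak g_N^*$ and, if $k=N/2$ and $m_{N/2}$ is odd, the first $m_{N/2}-1$ rows of $B_\ell^{N/2}$ are linearly independent. Equivalently: for all $1\le k\le\lfloor N/2\rfloor$, $B_\ell^k$ is invertible, except that when $k=N/2$ and $m_{N/2}$ is odd, $B_\ell^{N/2}$ has rank $m_{N/2}-1$ and its first $m_{N/2}-1$ rows are linearly independent. If $\ell$ satisfies these conditions, then for all $1\le k\le N-1$ and $1\le n\le m_{N-k}$ $$\dim\big(\mathcal O_\ell/\mathfrak g_N^*(N-k,n)\big)=\sum_{s=1}^{k-1}\dim(s,m_s)+\dim(k,n).$$ Moreover, for all $1\le k\le N-1$ and $n\ge 0$, $\dim(k,n)=\min\{m_k,m_{N-k},n\}$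 if $k\ne N/2$, while $\dim(N/2,n)$ equals $\min\{m_{N/2},n\}$ if $m_{N/2}$ is even and $\min\{m_{N/2}-1,n\}$ if $m_{N/2}$ is odd. -/

import Mathlib

open Module
open scoped ENNReal Nat

noncomputable section

/-- The truncated tensor algebra `T^N(ℝ^d) = ⨁_{k ≤ N} (ℝ^d)^{⊗ k}`: the tensor algebra of `ℝ^d`
modulo `⨁_{k > N} (ℝ^d)^{⊗ k}`, which is the `(N+1)`-st power of the augmentation ideal
(the kernel of the projection onto tensors of degree `0`). -/
def TruncTensor (N d : ℕ) : Type :=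
  TensorAlgebra ℝ (Fin d → ℝ) ⧸
    (RingHom.ker (TensorAlgebra.algebraMapInv (R := ℝ) (M := Fin d → ℝ))) ^ (N + 1)

instance (N d : ℕ) : Ring (TruncTensor N d) :=
  inferInstanceAs (Ring (TensorAlgebra ℝ (Fin d → ℝ) ⧸
    (RingHom.ker (TensorAlgebra.algebraMapInv (R := ℝ) (M := Fin d → ℝ))) ^ (N + 1)))

instance (N d : ℕ) : Algebra ℝ (TruncTensor N d) :=
  inferInstanceAs (Algebra ℝ (TensorAlgebra ℝ (Fin d → ℝ) ⧸
    (RingHom.ker (TensorAlgebra.algebraMapInv (R := ℝ) (M := Fin d → ℝ))) ^ (N + 1)))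

/-- The commutator bracket `[x, y] = x ⊗ y - y ⊗ x` on `T^N(ℝ^d)`. -/
instance (N d : ℕ) : LieRing (TruncTensor N d) := LieRing.ofAssociativeRing

instance (N d : ℕ) : LieAlgebra ℝ (TruncTensor N d) := LieAlgebra.ofAssociativeAlgebra

/-- The projection `T(ℝ^d) → T^N(ℝ^d)`. -/
def TruncTensor.mk (N d : ℕ) : TensorAlgebra ℝ (Fin d → ℝ) →ₐ[ℝ] TruncTensor N d :=
  Ideal.Quotient.mkₐ ℝ
    ((RingHom.ker (TensorAlgebra.algebraMapInv (R := ℝ) (M := Fin d → ℝ))) ^ (N + 1))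

/-- The inclusion of `ℝ^d` into `T^N(ℝ^d)` as the tensors of degree `1`. -/
def TruncTensor.gen (N d : ℕ) : (Fin d → ℝ) →ₗ[ℝ] TruncTensor N d :=
  (TruncTensor.mk N d).toLinearMap ∘ₗ TensorAlgebra.ι ℝ

/-- The free `N`-step nilpotent Lie algebra `𝔤_N(ℝ^d)`: the Lie subalgebra of `T^N(ℝ^d)`, with the
commutator bracket, generated by `ℝ^d`. -/
abbrev FreeNilp (N d : ℕ) : LieSubalgebra ℝ (TruncTensor N d) :=
  LieSubalgebra.lieSpan ℝ (TruncTensor N d) (Set.range (TruncTensor.gen N d))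

/-- The `k`-th layer of `𝔤_N(ℝ^d)` for `k ≥ 1`: the first layer is `ℝ^d`, and the `(k+1)`-st one is
spanned by the brackets `[x, y]` with `x` in the first and `y` in the `k`-th layer. -/
def layer (N d : ℕ) : ℕ → Submodule ℝ (FreeNilp N d)
  | 0 => ⊥
  | 1 => (LinearMap.range (TruncTensor.gen N d)).comap (FreeNilp N d).toSubmodule.subtype
  | k + 2 => Submodule.span ℝ
      {z | ∃ x ∈ layer N d 1, ∃ y ∈ layer N d (k + 1), z = ⁅x, y⁆}

/-- A basis `b` indexed by a linear order is a strong Malcev basis if the span of every initial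
segment of it is a subalgebra and an ideal. -/
def IsStrongMalcev {ι L : Type*} [LinearOrder ι] [LieRing L] [LieAlgebra ℝ L]
    (b : Basis ι ℝ L) : Prop :=
  ∀ j, (∃ K : LieSubalgebra ℝ L, K.toSubmodule = Submodule.span ℝ (b '' Set.Iic j)) ∧
    ∃ I : LieIdeal ℝ L, I.toSubmodule = Submodule.span ℝ (b '' Set.Iic j)

/-- The adjoint action `(Ad exp X) Y = ∑_k (ad X)^k Y / k!` on `𝔤_N(ℝ^d)`; the terms with
`k ≥ N` vanish. -/
def adExp {N d : ℕ} (X : FreeNilp N d) : FreeNilp N d →ₗ[ℝ] FreeNilp N d :=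
  ∑ k ∈ Finset.range (N + 1), ((k ! : ℝ)⁻¹) • (LieAlgebra.ad ℝ (FreeNilp N d) X) ^ k

/-- The coadjoint orbit of `ℓ`: the functionals `(Ad* exp X) ℓ = ℓ ∘ (Ad exp (-X))`. The group is
the image of the Lie algebra under `exp`. -/
def coadjointOrbit {N d : ℕ} (ℓ : Dual ℝ (FreeNilp N d)) : Set (Dual ℝ (FreeNilp N d)) :=
  Set.range fun X : FreeNilp N d => ℓ ∘ₗ adExp (-X)

section Orbits

variable {ι : Type*} [LinearOrder ι] {N d : ℕ}

/-- The image of the orbit of `ℓ` in `𝔤* / span {ℓ_i : i > j} = span {ℓ_i : i ≤ j}`, where `ℓ_i` is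
the basis dual to `b`, written in the coordinates `ℓ' ↦ (ℓ' (b i))_{i ≤ j}`. -/
def projOrbit (b : Basis ι ℝ (FreeNilp N d)) (ℓ : Dual ℝ (FreeNilp N d)) (j : ι) :
    Set ({i // i ≤ j} → ℝ) :=
  (fun (ℓ' : Dual ℝ (FreeNilp N d)) (i : {i // i ≤ j}) => ℓ' (b i)) '' coadjointOrbit ℓ

variable [Fintype ι]

/-- The dimension of the projected orbit. A projected orbit is an orbit of a Lie group, hence a
submanifold, and its dimension as a manifold is its Hausdorff dimension. -/
def projOrbitDim (b : Basis ι ℝ (FreeNilp N d)) (ℓ : Dual ℝ (FreeNilp N d)) (j : ι) : ℝ≥0∞ :=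
  dimH (projOrbit b ℓ j)

def HasMaximalOrbitDim (b : Basis ι ℝ (FreeNilp N d)) (ℓ : Dual ℝ (FreeNilp N d)) (j : ι) : Prop :=
  ∀ ℓ' : Dual ℝ (FreeNilp N d), projOrbitDim b ℓ' j ≤ projOrbitDim b ℓ j

def IsInGeneralPosition (b : Basis ι ℝ (FreeNilp N d)) (ℓ : Dual ℝ (FreeNilp N d)) : Prop :=
  ∀ j, HasMaximalOrbitDim b ℓ j

end Orbits

/-- The indices of a basis `X_1^N, …, X_{m_N}^N, …, X_1^1, …, X_{m_1}^1`, in this order: pairs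
of a layer `k ∈ {1, …, N}` and a (zero-based) position in `Fin (m k)`, with higher layers first. -/
abbrev LayerIndex (N : ℕ) (m : ℕ → ℕ) : Type :=
  Σₗ k : (Finset.Icc 1 N)ᵒᵈ, Fin (m ((OrderDual.ofDual k : Finset.Icc 1 N) : ℕ))

def LayerIndex.mk {N : ℕ} {m : ℕ → ℕ} (k : ℕ) (hk : k ∈ Finset.Icc 1 N) (i : Fin (m k)) :
    LayerIndex N m :=
  toLex ⟨OrderDual.toDual ⟨k, hk⟩, i⟩

/-- The layer of an index. -/
def LayerIndex.layer {N : ℕ} {m : ℕ → ℕ} (j : LayerIndex N m) : ℕ :=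
  (OrderDual.ofDual (ofLex j).1 : Finset.Icc 1 N)

/-- The position of an index in its layer, counted from `1`. -/
def LayerIndex.pos {N : ℕ} {m : ℕ → ℕ} (j : LayerIndex N m) : ℕ :=
  (ofLex j).2 + 1

instance (N : ℕ) (m : ℕ → ℕ) : Fintype (LayerIndex N m) :=
  Fintype.ofEquiv (Σ k : (Finset.Icc 1 N)ᵒᵈ, Fin (m ((OrderDual.ofDual k : Finset.Icc 1 N) : ℕ))) toLex

/-- For each `k ∈ {1, …, N}` the elements `X_1^k, …, X_{m_k}^k` are a basis of the `k`-th layer. -/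
def IsLayerAdapted {N d : ℕ} {m : ℕ → ℕ} (b : Basis (LayerIndex N m) ℝ (FreeNilp N d)) : Prop :=
  ∀ (k : ℕ) (hk : k ∈ Finset.Icc 1 N),
    Submodule.span ℝ (Set.range fun i : Fin (m k) => b (LayerIndex.mk k hk i)) = layer N d k

section Pairing

variable {N d : ℕ} {m : ℕ → ℕ}

/-- The basis vector `X_{i+1}^k`, and `0` if there is no such index. -/
def layerVec (b : Basis (LayerIndex N m) ℝ (FreeNilp N d)) (k i : ℕ) : FreeNilp N d :=
  if h : k ∈ Finset.Icc 1 N ∧ i < m k then b (LayerIndex.mk k h.1 ⟨i, h.2⟩) else 0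

/-- The matrix `B_ℓ^k(n) = (ℓ([X_i^k, X_j^{N-k}]))` with `1 ≤ i ≤ m_k` and `1 ≤ j ≤ n`. If
`n > m_{N-k}`, the columns beyond the `m_{N-k}`-th are zero. -/
def pairing (b : Basis (LayerIndex N m) ℝ (FreeNilp N d)) (ℓ : Dual ℝ (FreeNilp N d)) (k n : ℕ) :
    Matrix (Fin (m k)) (Fin n) ℝ :=
  Matrix.of fun i j => ℓ ⁅layerVec b k i, layerVec b (N - k) j⁆

/-- The square matrix `B_ℓ^k = B_ℓ^k(m_k)`. -/
def sqPairing (b : Basis (LayerIndex N m) ℝ (FreeNilp N d)) (ℓ : Dual ℝ (FreeNilp N d)) (k : ℕ) :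
    Matrix (Fin (m k)) (Fin (m k)) ℝ :=
  pairing b ℓ k (m k)

/-- `dim(k, n)`: the maximum over all functionals `ℓ` of the rank of `B_ℓ^k(n)`. -/
def pairingDim (b : Basis (LayerIndex N m) ℝ (FreeNilp N d)) (k n : ℕ) : ℕ :=
  sSup (Set.range fun ℓ : Dual ℝ (FreeNilp N d) => (pairing b ℓ k n).rank)

/-- The first `m_k - 1` rows of `B_ℓ^k` are linearly independent. -/
def FirstRowsIndependent (b : Basis (LayerIndex N m) ℝ (FreeNilp N d))
    (ℓ : Dual ℝ (FreeNilp N d)) (k : ℕ) : Prop :=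
  LinearIndependent ℝ fun i : Fin (m k - 1) =>
    (sqPairing b ℓ k) (Fin.castLE (Nat.sub_le (m k) 1) i)

end Pairing

end

/-! Everything reduces to the ranks of the pairings. If `b i` lies in layer `q`, then `ℓ (adExp X (b
i))` does not depend on the components of `X` in layers above `N - q`, and the component in layer `N
- q` enters linearly, through `B_ℓ^{N-q}`. Hence the differential of the orbit map at `0` is block
triangular, and the sum of the ranks of its blocks bounds the dimension of the projected orbit from
below (`IsLayerAdapted.le_projOrbitDim`). Conversely, a projected orbit lies in the image of a `C¹`
map whose parameters are the components of `X` in the layers below some `h`, a point in the range of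
the transpose of `B_ℓ^h(n)`, and free coordinates below layer `N - h`
(`IsLayerAdapted.projOrbitDim_le`). Taking `h = k` for `k ≤ N/2` and `h = N/2` beyond, and using
`m_s ≤ m_{N-s}` for `s < N/2`, one bounds all dimensions by sums of `maxRank`, the a priori bounds
for the ranks. Up to sign and transposition `B^{N-k}` comes from `B^k`, so `IsNondegenerate` forces
all ranks to be maximal. Once a nondegenerate functional exists, both bounds are sharp and every
condition of the theorem is equivalent to `IsNondegenerate`.

Existence is the algebraic core. Determinants are polynomials in `ℓ`, so each `k ≤ N/2` may be
treated alone, inside the free associative algebra. Order words lexicographically and let the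
smallest word of an element be its leading word. Independent elements of a layer may be put in
echelon form, with increasing leading words `u_i`, respectively `v_j`. If `u v ≠ v u`, then the
leading word of `[x, y]` is `min (u v) (v u)`, which increases strictly in `u` and in `v`; a matrix
with leading words increasing along rows and columns has nonzero determinant under some functional
(`exists_det_ne_zero_of_isLead`). In the middle layer the brackets `[x_i, x_j]`, `i < j`, are
independent, so an invertible skew matrix of even size can be prescribed.

It remains to see that leading words of Lie elements of different degrees do not commute
(`append_ne_append_of_length_lt`). If `u v = v u` with `u` nonempty and shorter, then `v = f g` such
that every shuffle of `f` and `g` is at most `v` (`exists_forall_shuffle_le`). A Lie element is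
primitive, so its coefficients sum to zero over the shuffles of `f` and `g`, with multiplicity. As
`v` is its smallest word, only the coefficient of `v` can survive in this sum, a contradiction. -/

/-! ### Shuffles of words -/

/-- `Shuffle f g w` says that the word `w` is a shuffle of the words `f` and `g`. -/
inductive Shuffle {α : Type} : List α → List α → List α → Prop
  | nil : Shuffle [] [] []
  | left {f g w : List α} (a : α) : Shuffle f g w → Shuffle (a :: f) g (a :: w)
  | right {f g w : List α} (a : α) : Shuffle f g w → Shuffle f (a :: g) (a :: w)

namespace Shuffle

variable {α : Type}

theorem symm {f g w : List α} (h : Shuffle f g w) : Shuffle g f w := by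
  induction h with
  | nil => exact .nil
  | left a _ ih => exact .right a ih
  | right a _ ih => exact .left a ih

theorem mem {f g w : List α} (h : Shuffle f g w) {a : α} (ha : a ∈ w) : a ∈ f ∨ a ∈ g := by
  induction h with
  | nil => simp at ha
  | left b _ ih => rcases List.mem_cons.1 ha with rfl | h' <;> grind
  | right b _ ih => rcases List.mem_cons.1 ha with rfl | h' <;> grind

theorem eq_of_nil_left {g w : List α} (h : Shuffle [] g w) : w = g := by
  generalize hf : ([] : List α) = f at h
  induction h with
  | nil => rfl
  | left a _ _ => simp at hf
  | right a _ ih => rw [ih hf]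

theorem append (f g : List α) : Shuffle f g (f ++ g) := by
  induction f with
  | nil =>
    induction g with
    | nil => exact .nil
    | cons a g ih => exact .right a ih
  | cons a f ih => exact .left a ih

variable [LinearOrder α]

/-- A letter that bounds a shuffle from above can be moved to the front. -/
theorem exists_le_cons {z : α} {f g w : List α} (h : Shuffle (z :: f) g w)
    (hg : ∀ a ∈ g, a ≤ z) : ∃ w', Shuffle f g w' ∧ w ≤ z :: w' := by
  generalize hf : z :: f = f' at h
  induction h with
  | nil => simp at hf
  | left a h _ =>
    obtain ⟨rfl, rfl⟩ := List.cons.inj hf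
    exact ⟨_, h, le_rfl⟩
  | @right f' g w a h ih =>
    obtain ⟨w', hw', hle⟩ := ih (fun a ha => hg a (List.mem_cons_of_mem _ ha)) hf
    refine ⟨a :: w', .right a hw', ?_⟩
    rcases (hg a List.mem_cons_self).lt_or_eq with h' | rfl
    · exact (List.cons_lt_cons_iff.2 (Or.inl h')).le
    · exact List.cons_le_cons _ hle

theorem exists_le_replicate {z : α} (i : ℕ) {f g w : List α}
    (h : Shuffle (List.replicate i z ++ f) g w) (hg : ∀ a ∈ g, a ≤ z) :
    ∃ w', Shuffle f g w' ∧ w ≤ List.replicate i z ++ w' := by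
  induction i generalizing w with
  | zero => exact ⟨w, by simpa using h, by simp⟩
  | succ i ih =>
    rw [List.replicate_succ, List.cons_append] at h
    obtain ⟨w₁, h₁, hle₁⟩ := h.exists_le_cons hg
    obtain ⟨w', h', hle⟩ := ih h₁
    exact ⟨w', h', hle₁.trans (by
      rw [List.replicate_succ, List.cons_append]; exact List.cons_le_cons _ hle)⟩

end Shuffle

/-! ### Words over the alphabet of blocks, and commuting words -/

/-- The word `e₁ z^i₁ e₂ z^i₂ ⋯` in which the block `(e, i)` stands for `e z^i`. -/
def unblock {α : Type} (z : α) : List (α ×ₗ ℕ) → List α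
  | [] => []
  | p :: t => (ofLex p).1 :: (List.replicate (ofLex p).2 z ++ unblock z t)

section Unblock

variable {α : Type} {z : α}

theorem unblock_append (U V : List (α ×ₗ ℕ)) : unblock z (U ++ V) = unblock z U ++ unblock z V := by
  induction U with
  | nil => rfl
  | cons p U ih => simp [unblock, ih]

theorem unblock_ne_nil {U : List (α ×ₗ ℕ)} (h : U ≠ []) : unblock z U ≠ [] := by
  cases U with
  | nil => exact absurd rfl h
  | cons p U => simp [unblock]

theorem length_le_length_unblock (U : List (α ×ₗ ℕ)) : U.length ≤ (unblock z U).length := by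
  induction U with
  | nil => simp
  | cons p U ih => simp [unblock]; omega

variable [LinearOrder α]

theorem length_lt_length_unblock {U : List (α ×ₗ ℕ)} (hU : ∀ p ∈ U, (ofLex p).1 < z)
    (h : z ∈ unblock z U) : U.length < (unblock z U).length := by
  induction U with
  | nil => simp [unblock] at h
  | cons p U ih =>
    simp only [unblock, List.mem_cons, List.mem_append, List.mem_replicate] at h
    have h1 := length_le_length_unblock (z := z) U
    simp only [unblock, List.length_cons, List.length_append, List.length_replicate]
    rcases h with h | h | h
    · exact absurd (hU p List.mem_cons_self) (by rw [← h]; exact lt_irrefl _)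
    · omega
    · have := ih (fun p hp => hU p (List.mem_cons_of_mem _ hp)) h
      omega

theorem le_of_mem_unblock {U : List (α ×ₗ ℕ)} (hU : ∀ p ∈ U, (ofLex p).1 < z) {a : α}
    (h : a ∈ unblock z U) : a ≤ z := by
  induction U with
  | nil => simp [unblock] at h
  | cons p U ih =>
    simp only [unblock, List.mem_cons, List.mem_append, List.mem_replicate] at h
    rcases h with rfl | h | h
    · exact (hU p List.mem_cons_self).le
    · exact h.2.le
    · exact ih (fun p hp => hU p (List.mem_cons_of_mem _ hp)) h

/-- After `i` copies of `z` the left word ends or opens a block, with a letter below `z`, while the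
right word continues with `z`. This is why blocks with a larger exponent have to count as larger. -/
theorem replicate_append_unblock_lt {U : List (α ×ₗ ℕ)} (hU : ∀ p ∈ U, (ofLex p).1 < z)
    {i j : ℕ} (hij : i < j) (w : List α) :
    List.replicate i z ++ unblock z U < List.replicate j z ++ w := by
  induction i generalizing j with
  | zero =>
    obtain ⟨j, rfl⟩ : ∃ k, j = k + 1 := ⟨j - 1, by omega⟩
    cases U with
    | nil => simp [unblock, List.replicate_succ]
    | cons p U =>
      simp only [unblock, List.replicate_succ, List.replicate_zero, List.nil_append,
        List.cons_append]
      exact List.cons_lt_cons_iff.2 (Or.inl (hU p List.mem_cons_self))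
  | succ i ih =>
    obtain ⟨j, rfl⟩ : ∃ k, j = k + 1 := ⟨j - 1, by omega⟩
    simp only [List.replicate_succ, List.cons_append]
    exact List.cons_lt_cons_iff.2 (Or.inr ⟨rfl, ih (by omega)⟩)

theorem append_lt_append_left' (w : List α) {u v : List α} (h : u < v) : w ++ u < w ++ v := by
  induction w with
  | nil => exact h
  | cons a w ih => exact List.cons_lt_cons_iff.2 (Or.inr ⟨rfl, ih⟩)

theorem unblock_lt_unblock {U V : List (α ×ₗ ℕ)} (hU : ∀ p ∈ U, (ofLex p).1 < z) (h : U < V) :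
    unblock z U < unblock z V := by
  induction U generalizing V with
  | nil =>
    cases V with
    | nil => simp at h
    | cons q V => simp [unblock]
  | cons p U ih =>
    cases V with
    | nil => simp at h
    | cons q V =>
      have hU' : ∀ p ∈ U, (ofLex p).1 < z := fun p hp => hU p (List.mem_cons_of_mem _ hp)
      simp only [unblock]
      rcases List.cons_lt_cons_iff.1 h with h | ⟨rfl, h'⟩
      · rcases (Prod.Lex.lt_iff).1 h with h | ⟨h₁, h₂⟩
        · exact List.cons_lt_cons_iff.2 (Or.inl h)
        · exact List.cons_lt_cons_iff.2 (Or.inr ⟨h₁, replicate_append_unblock_lt hU' h₂ _⟩)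
      · exact List.cons_lt_cons_iff.2 (Or.inr ⟨rfl, append_lt_append_left' _ (ih hU' h')⟩)

theorem unblock_injective {U V : List (α ×ₗ ℕ)} (hU : ∀ p ∈ U, (ofLex p).1 < z)
    (hV : ∀ p ∈ V, (ofLex p).1 < z) (h : unblock z U = unblock z V) : U = V := by
  rcases lt_trichotomy U V with h' | h' | h'
  · exact absurd h (unblock_lt_unblock hU h').ne
  · exact h'
  · exact absurd h (unblock_lt_unblock hV h').ne'

theorem exists_eq_replicate_append_unblock {v : List α} (hv : ∀ a ∈ v, a ≤ z) :
    ∃ (i : ℕ) (V : List (α ×ₗ ℕ)), v = List.replicate i z ++ unblock z V ∧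
      ∀ p ∈ V, (ofLex p).1 < z := by
  induction v with
  | nil => exact ⟨0, [], by simp [unblock], by simp⟩
  | cons a v ih =>
    obtain ⟨i, V, rfl, hV⟩ := ih fun a ha => hv a (List.mem_cons_of_mem _ ha)
    rcases (hv a List.mem_cons_self).lt_or_eq with h | rfl
    · refine ⟨0, toLex (a, i) :: V, by simp [unblock], ?_⟩
      intro p hp
      rcases List.mem_cons.1 hp with rfl | hp
      · exact h
      · exact hV p hp
    · exact ⟨i + 1, V, by simp [List.replicate_succ], hV⟩

theorem exists_eq_unblock {a : α} {v : List α} (hv : ∀ b ∈ a :: v, b ≤ z) (ha : a ≠ z) :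
    ∃ V : List (α ×ₗ ℕ), a :: v = unblock z V ∧ ∀ p ∈ V, (ofLex p).1 < z := by
  obtain ⟨i, V, h, hV⟩ := exists_eq_replicate_append_unblock hv
  cases i with
  | zero => exact ⟨V, by simpa using h, hV⟩
  | succ i =>
    rw [List.replicate_succ, List.cons_append] at h
    exact absurd (List.cons.inj h).1 ha

/-- The first letter of a shuffle opens a block. The copies of `z` that belong to this block can be
pulled forward until they follow it directly, which does not decrease the word because `z` is the
largest letter. The rest is a shuffle of block words with one block less. -/
theorem Shuffle.exists_le_unblock {F G : List (α ×ₗ ℕ)} (hF : ∀ p ∈ F, (ofLex p).1 < z)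
    (hG : ∀ p ∈ G, (ofLex p).1 < z) {w : List α} (h : Shuffle (unblock z F) (unblock z G) w) :
    ∃ W, Shuffle F G W ∧ w ≤ unblock z W := by
  induction hn : F.length + G.length using Nat.strong_induction_on generalizing F G w with
  | _ n IH =>
  -- The case of a first letter from the first factor, for arbitrary `F` and `G`, so that symmetry
  -- yields the other case.
  have key : ∀ {p F G w} (_ : ∀ q ∈ p :: F, (ofLex q).1 < z) (_ : ∀ q ∈ G, (ofLex q).1 < z)
      (_ : Shuffle (List.replicate (ofLex p).2 z ++ unblock z F) (unblock z G) w)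
      (_ : (p :: F).length + G.length = n),
      ∃ W, Shuffle (p :: F) G W ∧ (ofLex p).1 :: w ≤ unblock z W := by
    intro p F G w hF hG h hn
    have hF' : ∀ q ∈ F, (ofLex q).1 < z := fun q hq => hF q (List.mem_cons_of_mem _ hq)
    obtain ⟨w₁, h₁, hle⟩ := h.exists_le_replicate _ (fun a => le_of_mem_unblock hG)
    obtain ⟨W, hW, hle'⟩ := IH (F.length + G.length) (by rw [List.length_cons] at hn; omega) hF' hG h₁ rfl
    refine ⟨p :: W, .left p hW, List.cons_le_cons _ (hle.trans ?_)⟩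
    rcases hle'.lt_or_eq with h' | rfl
    · exact (append_lt_append_left' _ h').le
    · exact le_rfl
  generalize hf : unblock z F = f at h
  generalize hg : unblock z G = g at h
  cases h with
  | nil =>
    obtain rfl : F = [] := by by_contra h; exact unblock_ne_nil h hf
    obtain rfl : G = [] := by by_contra h; exact unblock_ne_nil h hg
    exact ⟨[], .nil, le_rfl⟩
  | left a h =>
    cases F with
    | nil => exact absurd hf (by simp [unblock])
    | cons p F =>
      obtain ⟨rfl, rfl⟩ := List.cons.inj hf
      subst hg
      exact key hF hG h hn
  | right a h =>
    cases G with
    | nil => exact absurd hg (by simp [unblock])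
    | cons p G =>
      obtain ⟨rfl, rfl⟩ := List.cons.inj hg
      subst hf
      obtain ⟨W, hW, hle⟩ := key hG hF h.symm (by rw [← hn]; exact Nat.add_comm _ _)
      exact ⟨W, hW.symm, hle⟩

end Unblock

theorem exists_mem_forall_le_of_ne_nil {α : Type} [LinearOrder α] {v : List α} (hv : v ≠ []) :
    ∃ z ∈ v, ∀ a ∈ v, a ≤ z := by
  induction v with
  | nil => exact absurd rfl hv
  | cons a v ih =>
    by_cases h : v = []
    · subst h; exact ⟨a, by simp, by simp⟩
    · obtain ⟨z, hz, hle⟩ := ih h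
      rcases le_total a z with h' | h'
      · exact ⟨z, by simp [hz], by simpa using ⟨h', hle⟩⟩
      · exact ⟨a, by simp, by simpa using fun b hb => (hle b hb).trans h'⟩

/-- The longer one of two commuting words is the largest one among the shuffles of a nonempty
prefix and the complementary suffix. -/
theorem exists_forall_shuffle_le {α : Type} [LinearOrder α] {u v : List α} (huv : u ++ v = v ++ u)
    (hu : u ≠ []) (hlt : u.length < v.length) :
    ∃ f g, f ≠ [] ∧ g ≠ [] ∧ v = f ++ g ∧ ∀ w, Shuffle f g w → w ≤ v := by
  induction hn : v.length using Nat.strong_induction_on generalizing α with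
  | _ n IH =>
  have hv : v ≠ [] := by rintro rfl; simp at hlt
  obtain ⟨z, hz, hle⟩ := exists_mem_forall_le_of_ne_nil hv
  obtain ⟨b, v', rfl⟩ := List.exists_cons_of_ne_nil hv
  obtain ⟨a, u', rfl⟩ := List.exists_cons_of_ne_nil hu
  -- If `v` starts with its largest letter, this letter can be split off. The rest is nonempty since
  -- `u` is nonempty and shorter than `v`.
  by_cases hb : b = z
  · subst hb
    refine ⟨[b], v', by simp, ?_, rfl, fun w hw => ?_⟩
    · rintro rfl
      simp at hlt
    · obtain ⟨w', hw', h⟩ := hw.exists_le_cons fun a ha => hle a (List.mem_cons_of_mem _ ha)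
      rwa [hw'.eq_of_nil_left] at h
  -- Otherwise `u`, a prefix of `v`, also starts with a letter other than `z`, and both words split
  -- into blocks `e z^i`. The block words still commute, and `V` is shorter than `v` because `z`
  -- occurs in `v`, so the induction hypothesis applies over the alphabet of blocks.
  · have hab : a = b := by simpa using congrArg List.head? huv
    subst hab
    have hpre : (a :: u') <+: (a :: v') :=
      List.prefix_of_prefix_length_le (l₃ := (a :: v') ++ (a :: u'))
        ⟨a :: v', huv⟩ ⟨a :: u', rfl⟩ hlt.le
    obtain ⟨V, hV, hVz⟩ := exists_eq_unblock hle hb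
    obtain ⟨U, hU, hUz⟩ := exists_eq_unblock (fun c hc => hle c (hpre.subset hc)) hb
    have hUne : U ≠ [] := by rintro rfl; simp [unblock] at hU
    have hUV : U ++ V = V ++ U := by
      refine unblock_injective (z := z) ?_ ?_ ?_
      · intro p hp; rcases List.mem_append.1 hp with h | h; exacts [hUz p h, hVz p h]
      · intro p hp; rcases List.mem_append.1 hp with h | h; exacts [hVz p h, hUz p h]
      · rw [unblock_append, unblock_append, ← hU, ← hV, huv]
    have hlt' : U.length < V.length := by
      by_contra hcon
      obtain ⟨t, rfl⟩ : V <+: U := List.prefix_of_prefix_length_le (l₃ := U ++ V)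
        ⟨U, hUV.symm⟩ ⟨V, rfl⟩ (not_lt.1 hcon)
      rw [hU, hV, unblock_append, List.length_append] at hlt
      omega
    have hlen : V.length < (a :: v').length := by
      rw [hV] at hz ⊢
      exact length_lt_length_unblock hVz hz
    obtain ⟨F, G, hF, hG, rfl, hFG⟩ := IH V.length (hn ▸ hlen) hUV hUne hlt' rfl
    have hFz : ∀ p ∈ F, (ofLex p).1 < z := fun p hp => hVz p (List.mem_append_left _ hp)
    have hGz : ∀ p ∈ G, (ofLex p).1 < z := fun p hp => hVz p (List.mem_append_right _ hp)
    refine ⟨unblock z F, unblock z G, unblock_ne_nil hF, unblock_ne_nil hG,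
      hV.trans (unblock_append _ _), fun w hw => ?_⟩
    obtain ⟨W, hW, hle'⟩ := hw.exists_le_unblock hFz hGz
    rw [hV]
    refine hle'.trans ?_
    rcases (hFG W hW).lt_or_eq with h | rfl
    · refine (unblock_lt_unblock (fun p hp => ?_) h).le
      rcases hW.mem hp with h | h
      exacts [hFz p h, hGz p h]
    · exact le_rfl

/-! ### Leading terms, echelon bases and determinants -/

/-- `t` is the smallest element of the support of `p`. -/
def IsLead {Γ : Type} [LinearOrder Γ] (p : Γ → ℝ) (t : Γ) : Prop :=
  p t ≠ 0 ∧ ∀ s < t, p s = 0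

section Lead

variable {Γ : Type} [LinearOrder Γ] {E : Type} [AddCommGroup E] [Module ℝ E]

theorem IsLead.sub {p q : Γ → ℝ} {s t : Γ} (hp : IsLead p s) (hq : IsLead q t) (h : s ≠ t) :
    IsLead (p - q) (min s t) := by
  rcases h.lt_or_gt with h | h
  · rw [min_eq_left h.le]
    refine ⟨by simpa [hq.2 _ h] using hp.1, fun r hr => ?_⟩
    simp [hp.2 _ hr, hq.2 _ (hr.trans h)]
  · rw [min_eq_right h.le]
    refine ⟨by simpa [hp.2 _ h] using hq.1, fun r hr => ?_⟩
    simp [hq.2 _ hr, hp.2 _ (hr.trans h)]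

/-- In a linear relation, look at the smallest lead that occurs with a nonzero coefficient: no other
term contributes there. -/
theorem linearIndependent_of_isLead {ι : Type} (c : Γ → Dual ℝ E) {x : ι → E} {u : ι → Γ}
    (hx : ∀ i, IsLead (fun s => c s (x i)) (u i)) (hu : Function.Injective u) :
    LinearIndependent ℝ x := by
  classical
  rw [linearIndependent_iff']
  intro s g hg i hi
  by_contra hne
  obtain ⟨j, hj, hmin⟩ := (s.filter fun i => g i ≠ 0).exists_min_image u
    ⟨i, Finset.mem_filter.2 ⟨hi, hne⟩⟩
  have h := congrArg (c (u j)) hg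
  rw [map_sum, map_zero, Finset.sum_eq_single j] at h
  · rw [map_smul, smul_eq_mul] at h
    exact (mul_ne_zero (Finset.mem_filter.1 hj).2 (hx j).1) h
  · intro k hk hkj
    by_cases hgk : g k = 0
    · simp [hgk]
    · have := lt_of_le_of_ne (hmin k (Finset.mem_filter.2 ⟨hk, hgk⟩)) fun h => hkj (hu h).symm
      rw [map_smul, show c (u j) (x k) = 0 from (hx k).2 _ this, smul_zero]
  · exact fun h => absurd (Finset.mem_filter.1 hj).1 h

/-- Every finite-dimensional subspace has an echelon basis. -/
theorem exists_echelon (c : Γ → Dual ℝ E) (S : Set Γ) (hS : S.Finite) (n : ℕ) (V : Submodule ℝ E)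
    [FiniteDimensional ℝ V] (hn : finrank ℝ V = n) (h0 : ∀ s ∉ S, ∀ x ∈ V, c s x = 0)
    (hsep : ∀ x ∈ V, (∀ s, c s x = 0) → x = 0) :
    ∃ (x : Fin n → E) (u : Fin n → Γ), StrictMono u ∧ (∀ i, x i ∈ V) ∧
      ∀ i, IsLead (fun s => c s (x i)) (u i) := by
  classical
  induction n generalizing V with
  | zero => exact ⟨Fin.elim0, Fin.elim0, fun i => i.elim0, fun i => i.elim0, fun i => i.elim0⟩
  | succ n ih =>
    obtain ⟨y, hyV, hy⟩ : ∃ y ∈ V, y ≠ 0 := by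
      refine V.ne_bot_iff.1 ?_
      rintro rfl
      simp at hn
    have hne : {t ∈ S | ∃ x ∈ V, c t x ≠ 0}.Nonempty := by
      by_contra hcon
      refine hy (hsep y hyV fun s => ?_)
      by_contra hs
      exact hcon ⟨s, by by_contra h; exact hs (h0 s h y hyV), y, hyV, hs⟩
    -- `u₀` is the smallest lead occurring in `V`. The vectors of `V` with vanishing coefficient at
    -- `u₀` form a hyperplane, and all their leads are larger.
    obtain ⟨u₀, ⟨-, x₀, hx₀V, hx₀⟩, hmin⟩ :=
      Set.exists_min_image _ id (hS.subset (Set.sep_subset S _)) hne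
    have hlow : ∀ s < u₀, ∀ x ∈ V, c s x = 0 := by
      intro s hs x hx
      by_contra h
      exact (hmin s ⟨by by_contra h'; exact h (h0 s h' x hx), x, hx, h⟩).not_gt hs
    have hf : (c u₀).domRestrict V ≠ 0 := fun h => hx₀ (LinearMap.congr_fun h ⟨x₀, hx₀V⟩)
    have hker := Module.Dual.finrank_ker_add_one_of_ne_zero hf
    set V' : Submodule ℝ E := V ⊓ LinearMap.ker (c u₀)
    have hV' : finrank ℝ V' = n := by
      have e : Submodule.map V.subtype (LinearMap.ker ((c u₀).domRestrict V)) = V' := by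
        ext x
        simp [V', LinearMap.domRestrict_apply, and_comm]
      rw [← e, Submodule.finrank_map_subtype_eq]
      omega
    have : FiniteDimensional ℝ V' := Submodule.finiteDimensional_of_le inf_le_left
    obtain ⟨x, u, hu, hxV, hlead⟩ := ih V' hV' (fun s hs x hx => h0 s hs x hx.1)
      fun x hx => hsep x hx.1
    have hgt : ∀ i, u₀ < u i := by
      intro i
      by_contra h
      rcases (not_lt.1 h).lt_or_eq with h | h
      · exact (hlead i).1 (hlow _ h _ (hxV i).1)
      · exact (hlead i).1 (by rw [h]; exact (hxV i).2)
    refine ⟨Fin.cons x₀ x, Fin.cons u₀ u, ?_, ?_, ?_⟩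
    · intro i j hij
      cases j using Fin.cases with
      | zero => exact absurd hij (by simp)
      | succ j =>
        cases i using Fin.cases with
        | zero => simpa using hgt j
        | succ i => simpa using hu (by simpa using hij)
    · intro i
      cases i using Fin.cases with
      | zero => simpa using hx₀V
      | succ i => simpa using (hxV i).1
    · intro i
      cases i using Fin.cases with
      | zero => exact ⟨by simpa using hx₀, fun s hs => by simpa using hlow s hs x₀ hx₀V⟩
      | succ i => simpa using hlead i

/-- A matrix whose leading terms increase along rows and columns has nonzero determinant under
some functional. -/
theorem exists_det_ne_zero_of_isLead (c : Γ → Dual ℝ E) (n : ℕ) (p : Fin n → Fin n → E)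
    (t : Fin n → Fin n → Γ) (hrow : ∀ i, StrictMono (t i)) (hcol : ∀ j, StrictMono fun i => t i j)
    (hp : ∀ i j, IsLead (fun s => c s (p i j)) (t i j)) :
    ∃ Λ ∈ Submodule.span ℝ {Λ | ∃ i j, Λ = c (t i j)},
      (Matrix.of fun i j => Λ (p i j)).det ≠ 0 := by
  induction n with
  | zero => exact ⟨0, Submodule.zero_mem _, by simp⟩
  | succ n ih =>
    obtain ⟨Λ, hΛ, hdet⟩ := ih (fun i j => p i.succ j.succ) (fun i j => t i.succ j.succ)
      (fun i _ _ h => hrow _ (Fin.succ_lt_succ_iff.2 h))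
      (fun j _ _ h => hcol _ (Fin.succ_lt_succ_iff.2 h)) (fun i j => hp _ _)
    -- The corner has the strictly smallest lead, so the functional `c (t 0 0)` vanishes on all
    -- other entries.
    have hlt : ∀ i j, (i ≠ 0 ∨ j ≠ 0) → t 0 0 < t i j := by
      intro i j h
      rcases eq_or_ne j 0 with rfl | hj
      · exact hcol 0 (Fin.pos_of_ne_zero (by simpa using h))
      · exact ((hcol 0).monotone (Fin.zero_le i)).trans_lt (hrow i (Fin.pos_of_ne_zero hj))
    have hzero : ∀ i j, (i ≠ 0 ∨ j ≠ 0) → c (t 0 0) (p i j) = 0 :=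
      fun i j h => (hp i j).2 _ (hlt i j h)
    have hmin : ∀ r : ℝ, ∀ j : Fin (n + 1), (Matrix.of fun i j =>
        (Λ + r • c (t 0 0)) (p i j)).submatrix Fin.succ j.succAbove =
        (Matrix.of fun i j => Λ (p i j)).submatrix Fin.succ j.succAbove := by
      intro r j
      ext i k
      simp [hzero i.succ (j.succAbove k) (Or.inl (Fin.succ_ne_zero i))]
    -- Only the corner entry varies with `r`. The determinant is therefore affine in `r`, and its
    -- slope is nonzero by the induction hypothesis for the complementary minor.
    have hdetr : ∀ r : ℝ, (Matrix.of fun i j => (Λ + r • c (t 0 0)) (p i j)).det =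
        (Matrix.of fun i j => Λ (p i j)).det + r * (c (t 0 0) (p 0 0) *
          (Matrix.of fun i j : Fin n => Λ (p i.succ j.succ)).det) := by
      intro r
      rw [Matrix.det_succ_row_zero, Matrix.det_succ_row_zero, Fin.sum_univ_succ, Fin.sum_univ_succ]
      simp only [hmin]
      have : ∀ j : Fin n, (Matrix.of fun i j => (Λ + r • c (t 0 0)) (p i j)) 0 j.succ =
          (Matrix.of fun i j => Λ (p i j)) 0 j.succ := by
        intro j
        simp [hzero 0 j.succ (Or.inr (Fin.succ_ne_zero j))]
      simp only [this]
      have h2 : (Matrix.of fun i j => Λ (p i j)).submatrix Fin.succ (Fin.succAbove 0) =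
          (Matrix.of fun i j : Fin n => Λ (p i.succ j.succ)) := by
        ext i j; simp
      rw [h2]
      simp
      ring
    have hne : c (t 0 0) (p 0 0) * (Matrix.of fun i j : Fin n => Λ (p i.succ j.succ)).det ≠ 0 :=
      mul_ne_zero (hp 0 0).1 hdet
    set a := (Matrix.of fun i j => Λ (p i j)).det
    set e := c (t 0 0) (p 0 0) * (Matrix.of fun i j : Fin n => Λ (p i.succ j.succ)).det
    -- This multiple makes the determinant equal to `1`.
    refine ⟨Λ + ((1 - a) / e) • c (t 0 0), ?_, ?_⟩
    · refine Submodule.add_mem _ (Submodule.span_mono ?_ hΛ)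
        (Submodule.smul_mem _ _ (Submodule.subset_span ⟨0, 0, rfl⟩))
      rintro _ ⟨i, j, rfl⟩
      exact ⟨_, _, rfl⟩
    · rw [hdetr, div_mul_cancel₀ _ hne]
      simp

end Lead

/-! ### The lexicographic order and concatenation -/

section ListOrder

variable {α : Type} [LinearOrder α]

theorem append_lt_append_iff_of_length_eq {a b u v : List α} (h : a.length = u.length) :
    a ++ b < u ++ v ↔ a < u ∨ a = u ∧ b < v := by
  induction a generalizing u with
  | nil =>
    obtain rfl : u = [] := List.length_eq_zero_iff.1 h.symm
    simp
  | cons x a ih =>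
    cases u with
    | nil => simp at h
    | cons y u =>
      simp only [List.cons_append, List.cons_lt_cons_iff, ih (Nat.succ.inj h), List.cons.injEq]
      tauto

/-- The smaller one of the two concatenations of `u` and `v`. -/
def minConcat (u v : List α) : List α := min (u ++ v) (v ++ u)

/-- Both concatenations increase; `v ++ u < v' ++ u` needs the equal lengths. -/
theorem minConcat_lt_minConcat_right {u v v' : List α} (h : v < v') (hl : v.length = v'.length) :
    minConcat u v < minConcat u v' :=
  min_lt_min ((append_lt_append_iff_of_length_eq rfl).2 (Or.inr ⟨rfl, h⟩))
    ((append_lt_append_iff_of_length_eq hl).2 (Or.inl h))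

theorem minConcat_comm (u v : List α) : minConcat u v = minConcat v u := min_comm _ _

theorem length_minConcat (u v : List α) : (minConcat u v).length = u.length + v.length := by
  rcases min_choice (u ++ v) (v ++ u) with h | h <;> simp [minConcat, h, add_comm]

end ListOrder

/-! ### The free associative algebra and its Lie elements -/

noncomputable section

/-- The free associative algebra on the letters `α`, with the words in `α` as a basis. -/
abbrev WordAlg (α : Type) : Type := MonoidAlgebra ℝ (FreeMonoid α)

instance (α : Type) : LieRing (WordAlg α) := LieRing.ofAssociativeRing

instance (α : Type) : LieAlgebra ℝ (WordAlg α) := LieAlgebra.ofAssociativeAlgebra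

namespace WordAlg

variable {α : Type}

def letter (a : α) : WordAlg α := MonoidAlgebra.single (FreeMonoid.of a) 1

/-- The coefficient of a word, as a functional. -/
def coeffL (w : List α) : Dual ℝ (WordAlg α) :=
  Finsupp.lapply (FreeMonoid.ofList w) ∘ₗ (MonoidAlgebra.coeffLinearEquiv ℝ).toLinearMap

theorem coeffL_apply (w : List α) (x : WordAlg α) :
    coeffL w x = x.coeff (FreeMonoid.ofList w) := rfl

theorem ext_coeffL {x y : WordAlg α} (h : ∀ w, coeffL w x = coeffL w y) : x = y :=
  MonoidAlgebra.coeff_injective (Finsupp.ext h)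

theorem coeffL_single [DecidableEq α] (w u : List α) (r : ℝ) :
    coeffL w (MonoidAlgebra.single (FreeMonoid.ofList u) r) = if u = w then r else 0 := by
  rw [coeffL_apply, MonoidAlgebra.coeff_single]
  split_ifs with h
  · rw [h, Finsupp.single_eq_same]
  · exact Finsupp.single_eq_of_ne fun h' => h h'.symm

/-- The homogeneous elements of degree `k`. -/
def homog (α : Type) (k : ℕ) : Submodule ℝ (WordAlg α) where
  carrier := {x | ∀ w : List α, w.length ≠ k → coeffL w x = 0}
  zero_mem' w _ := map_zero _
  add_mem' hx hy w hw := by rw [map_add, hx w hw, hy w hw, add_zero]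
  smul_mem' r x hx w hw := by rw [map_smul, hx w hw, smul_zero]

theorem letter_mem_homog (a : α) : letter a ∈ homog α 1 := by
  classical
  intro w hw
  refine (coeffL_single w [a] 1).trans (if_neg ?_)
  rintro rfl
  exact hw rfl

/-- As `x` is homogeneous, `w` can be factored in at most one way. For `w` shorter than `k` both
sides vanish. -/
theorem coeffL_mul {k : ℕ} {x : WordAlg α} (hx : x ∈ homog α k) (y : WordAlg α)
    (w : List α) : coeffL w (x * y) = coeffL (w.take k) x * coeffL (w.drop k) y := by
  classical
  have hsum : x = ∑ u ∈ x.coeff.support, MonoidAlgebra.single u (x.coeff u) :=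
    (MonoidAlgebra.sum_coeff_single x).symm
  have hlen : ∀ u ∈ x.coeff.support, u.toList.length = k := by
    intro u hu
    by_contra h
    exact Finsupp.mem_support_iff.1 hu (hx u.toList h)
  have h1 : ∀ u ∈ x.coeff.support, coeffL w (MonoidAlgebra.single u (x.coeff u) * y) =
      coeffL (w.take k) (MonoidAlgebra.single u (x.coeff u)) * coeffL (w.drop k) y := by
    intro u hu
    rw [show u = FreeMonoid.ofList u.toList from rfl, coeffL_single]
    split_ifs with h
    · refine MonoidAlgebra.coeff_single_mul_eq_mul_coeff _ fun m _ => ?_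
      rw [h, ← FreeMonoid.toList.injective.eq_iff, ← FreeMonoid.toList.injective.eq_iff]
      simp only [FreeMonoid.toList_mul, FreeMonoid.toList_ofList]
      nth_rw 2 [← List.take_append_drop k w]
      exact List.append_right_inj _
    · rw [zero_mul]
      refine MonoidAlgebra.coeff_single_mul_of_forall_mul_ne _ _ fun m hm => h ?_
      have hm' : u.toList ++ m.toList = w := hm
      rw [← hm', ← hlen u hu, List.take_left]
  conv_lhs => rw [hsum, Finset.sum_mul, map_sum, Finset.sum_congr rfl h1, ← Finset.sum_mul,
    ← map_sum, ← hsum]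

theorem mul_mem_homog {k l : ℕ} {x y : WordAlg α} (hx : x ∈ homog α k) (hy : y ∈ homog α l) :
    x * y ∈ homog α (k + l) := by
  intro w hw
  rw [coeffL_mul hx]
  by_cases hk : (w.take k).length = k
  · rw [hy _ (by rw [List.length_take] at hk; rw [List.length_drop]; omega), mul_zero]
  · rw [hx _ hk, zero_mul]

theorem lie_mem_homog {k l : ℕ} {x y : WordAlg α} (hx : x ∈ homog α k) (hy : y ∈ homog α l) :
    ⁅x, y⁆ ∈ homog α (k + l) := by
  rw [Ring.lie_def]
  exact Submodule.sub_mem _ (mul_mem_homog hx hy) (by rw [add_comm]; exact mul_mem_homog hy hx)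

/-- The layers of the free Lie algebra inside the free associative algebra. -/
def lieLayer (α : Type) : ℕ → Submodule ℝ (WordAlg α)
  | 0 => ⊥
  | 1 => Submodule.span ℝ (Set.range letter)
  | k + 2 => Submodule.span ℝ {z | ∃ x ∈ lieLayer α 1, ∃ y ∈ lieLayer α (k + 1), z = ⁅x, y⁆}

theorem lieLayer_zero : lieLayer α 0 = ⊥ := by rw [lieLayer]

theorem lieLayer_one : lieLayer α 1 = Submodule.span ℝ (Set.range letter) := by rw [lieLayer]

theorem lieLayer_add_two (k : ℕ) : lieLayer α (k + 2) =
    Submodule.span ℝ {z | ∃ x ∈ lieLayer α 1, ∃ y ∈ lieLayer α (k + 1), z = ⁅x, y⁆} := by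
  conv_lhs => rw [lieLayer]

theorem lieLayer_le_homog (k : ℕ) : lieLayer α k ≤ homog α k := by
  induction k using Nat.strong_induction_on with
  | _ k ih =>
    match k, ih with
    | 0, _ => rw [lieLayer_zero]; exact bot_le
    | 1, _ =>
      rw [lieLayer_one]
      refine Submodule.span_le.2 ?_
      rintro _ ⟨a, rfl⟩
      exact letter_mem_homog a
    | k + 2, ih =>
      rw [lieLayer_add_two]
      refine Submodule.span_le.2 ?_
      rintro _ ⟨x, hx, y, hy, rfl⟩
      have := lie_mem_homog (ih 1 (by omega) hx) (ih (k + 1) (by omega) hy)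
      rwa [show 1 + (k + 1) = k + 2 by omega] at this

/-! ### The coproduct and shuffles -/

section Coproduct

/-- The words over two disjoint copies of `α` whose letters from different copies commute. -/
abbrev PairAlg (α : Type) : Type := MonoidAlgebra ℝ (FreeMonoid α × FreeMonoid α)

def inl (α : Type) : WordAlg α →ₐ[ℝ] PairAlg α :=
  MonoidAlgebra.mapDomainAlgHom ℝ ℝ (MonoidHom.inl (FreeMonoid α) (FreeMonoid α))

def inr (α : Type) : WordAlg α →ₐ[ℝ] PairAlg α :=
  MonoidAlgebra.mapDomainAlgHom ℝ ℝ (MonoidHom.inr (FreeMonoid α) (FreeMonoid α))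

theorem inl_single (u : FreeMonoid α) (r : ℝ) :
    inl α (MonoidAlgebra.single u r) = MonoidAlgebra.single (u, 1) r :=
  MonoidAlgebra.mapDomain_single

theorem inr_single (u : FreeMonoid α) (r : ℝ) :
    inr α (MonoidAlgebra.single u r) = MonoidAlgebra.single (1, u) r :=
  MonoidAlgebra.mapDomain_single

/-- The coproduct for which the letters are primitive. -/
def coprod (α : Type) : WordAlg α →ₐ[ℝ] PairAlg α :=
  MonoidAlgebra.lift ℝ _ _ (FreeMonoid.lift fun a => inl α (letter a) + inr α (letter a))

theorem commute_inl_inr (x y : WordAlg α) : Commute (inl α x) (inr α y) := by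
  induction x using MonoidAlgebra.induction_linear with
  | zero => rw [map_zero]; exact Commute.zero_left _
  | add f g hf hg => rw [map_add]; exact hf.add_left hg
  | single u r =>
    induction y using MonoidAlgebra.induction_linear with
    | zero => rw [map_zero]; exact Commute.zero_right _
    | add f g hf hg => rw [map_add]; exact hf.add_right hg
    | single v s =>
      rw [inl_single, inr_single]
      exact MonoidAlgebra.single_commute_single
        (by simp [Commute, SemiconjBy]) (Commute.all _ _)

theorem coprod_letter (a : α) : coprod α (letter a) = inl α (letter a) + inr α (letter a) := by
  simp only [coprod, letter, MonoidAlgebra.lift_single, FreeMonoid.lift_eval_of, one_smul]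

/-- Primitive elements are closed under brackets: the two copies of the algebra commute, so the
mixed products cancel. -/
theorem coprod_of_mem_lieLayer {k : ℕ} {x : WordAlg α} (hx : x ∈ lieLayer α k) :
    coprod α x = inl α x + inr α x := by
  have hadd : ∀ {s : Set (WordAlg α)}, (∀ x ∈ s, coprod α x = inl α x + inr α x) →
      ∀ x ∈ Submodule.span ℝ s, coprod α x = inl α x + inr α x := by
    intro s hs x hx
    induction hx using Submodule.span_induction with
    | mem x h => exact hs x h
    | zero => simp
    | add x y _ _ hx hy => simp only [map_add, hx, hy]; abel
    | smul r x _ hx => simp only [map_smul, hx, smul_add]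
  induction k using Nat.strong_induction_on generalizing x with
  | _ k ih =>
    match k, ih with
    | 0, _ =>
      rw [lieLayer_zero, Submodule.mem_bot] at hx
      subst hx
      simp
    | 1, _ =>
      rw [lieLayer_one] at hx
      refine hadd ?_ x hx
      rintro _ ⟨a, rfl⟩
      exact coprod_letter a
    | k + 2, ih =>
      rw [lieLayer_add_two] at hx
      refine hadd ?_ x hx
      rintro _ ⟨x, hx, y, hy, rfl⟩
      simp only [Ring.lie_def, map_sub, map_mul, ih 1 (by omega) hx, ih (k + 1) (by omega) hy]
      have h1 := (commute_inl_inr x y).eq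
      have h2 := (commute_inl_inr y x).eq
      simp only [add_mul, mul_add, h1, h2]
      abel

/-- The pairs of words of which a given word is a shuffle, with multiplicity. -/
def splits : List α → List (List α × List α)
  | [] => [([], [])]
  | a :: w => (splits w).map (fun p => (a :: p.1, p.2)) ++ (splits w).map (fun p => (p.1, a :: p.2))

theorem shuffle_of_mem_splits {f g w : List α} (h : (f, g) ∈ splits w) : Shuffle f g w := by
  induction w generalizing f g with
  | nil =>
    simp only [splits, List.mem_singleton, Prod.mk.injEq] at h
    obtain ⟨rfl, rfl⟩ := h
    exact .nil
  | cons a w ih =>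
    simp only [splits, List.mem_append, List.mem_map, Prod.mk.injEq, Prod.exists] at h
    rcases h with ⟨f', g', h, rfl, rfl⟩ | ⟨f', g', h, rfl, rfl⟩
    · exact .left a (ih h)
    · exact .right a (ih h)

theorem mem_splits_of_shuffle {f g w : List α} (h : Shuffle f g w) : (f, g) ∈ splits w := by
  induction h with
  | nil => simp [splits]
  | left a _ ih => exact List.mem_append_left _ (List.mem_map.2 ⟨_, ih, rfl⟩)
  | right a _ ih => exact List.mem_append_right _ (List.mem_map.2 ⟨_, ih, rfl⟩)

theorem coprod_single (w : List α) (r : ℝ) :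
    coprod α (MonoidAlgebra.single (FreeMonoid.ofList w) r) = ((splits w).map fun p =>
      MonoidAlgebra.single (FreeMonoid.ofList p.1, FreeMonoid.ofList p.2) r).sum := by
  induction w with
  | nil =>
    simp [coprod, splits, MonoidAlgebra.lift_single]
    rw [Algebra.smul_def, mul_one]; rfl
  | cons a w ih =>
    have h : (MonoidAlgebra.single (FreeMonoid.ofList (a :: w)) r : WordAlg α) =
        letter a * MonoidAlgebra.single (FreeMonoid.ofList w) r := by
      rw [letter, MonoidAlgebra.single_mul_single, one_mul]; rfl
    rw [h, map_mul, ih, coprod_letter, letter, inl_single, inr_single, add_mul]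
    simp only [splits, List.map_append, List.sum_append, List.map_map]
    rw [← List.sum_map_mul_left, ← List.sum_map_mul_left]
    congr 2 <;> refine List.map_congr_left fun p _ => ?_ <;>
      simp [FreeMonoid.ofList_cons]

/-- The coproduct is dual to the shuffle product: `w` contributes to `f ⊗ g` once for each way of
reading it as a shuffle of `f` and `g`. -/
theorem coeff_coprod [DecidableEq α] (x : WordAlg α) (f g : List α) :
    (coprod α x).coeff (FreeMonoid.ofList f, FreeMonoid.ofList g) =
      ∑ w ∈ x.coeff.support, ((splits w.toList).count (f, g) : ℝ) * coeffL w.toList x := by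
  have hsum : x = ∑ u ∈ x.coeff.support, MonoidAlgebra.single u (x.coeff u) :=
    (MonoidAlgebra.sum_coeff_single x).symm
  conv_lhs => rw [hsum, map_sum, MonoidAlgebra.coeff_sum, Finsupp.finsetSum_apply]
  refine Finset.sum_congr rfl fun w _ => ?_
  change _ = _ * x.coeff w
  generalize x.coeff w = r
  rw [show w = FreeMonoid.ofList w.toList from rfl, coprod_single]
  simp only [FreeMonoid.toList_ofList]
  induction splits w.toList with
  | nil => simp
  | cons p l ih =>
    rw [List.map_cons, List.sum_cons, MonoidAlgebra.coeff_add, Finsupp.add_apply, ih,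
      List.count_cons, MonoidAlgebra.coeff_single]
    by_cases h : p = (f, g)
    · simp [h]; ring
    · rw [Finsupp.single_eq_of_ne fun h' => h (by simpa [Prod.ext_iff] using h'.symm)]
      simp [h]

end Coproduct

/-! ### Leading words of brackets -/

variable [LinearOrder α]

/-- `u` is the smallest word that occurs in `x`. -/
abbrev IsLeadWord (x : WordAlg α) (u : List α) : Prop := IsLead (fun s => coeffL s x) u

theorem IsLeadWord.length_eq {k : ℕ} {x : WordAlg α} {u : List α} (h : IsLeadWord x u)
    (hx : x ∈ homog α k) : u.length = k := by
  by_contra hne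
  exact h.1 (hx u hne)

theorem IsLeadWord.ne_zero {x : WordAlg α} {u : List α} (h : IsLeadWord x u) : x ≠ 0 := by
  rintro rfl
  exact h.1 (map_zero _)

theorem exists_isLeadWord {x : WordAlg α} (hx : x ≠ 0) : ∃ u, IsLeadWord x u := by
  have hne : x.coeff.support.Nonempty := by
    rw [Finsupp.support_nonempty_iff]
    exact fun h => hx (MonoidAlgebra.coeff_eq_zero.1 h)
  obtain ⟨u, hu, hmin⟩ := x.coeff.support.exists_min_image FreeMonoid.toList hne
  refine ⟨u.toList, Finsupp.mem_support_iff.1 hu, fun s hs => ?_⟩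
  by_contra h
  exact (hmin (FreeMonoid.ofList s) (Finsupp.mem_support_iff.2 h)).not_gt hs

theorem IsLeadWord.mul {k l : ℕ} {x y : WordAlg α} {u v : List α} (hx : x ∈ homog α k)
    (hy : y ∈ homog α l) (hu : IsLeadWord x u) (hv : IsLeadWord y v) :
    IsLeadWord (x * y) (u ++ v) := by
  have hul := hu.length_eq hx
  refine ⟨?_, fun w hw => ?_⟩
  · change coeffL (u ++ v) (x * y) ≠ 0
    rw [coeffL_mul hx, ← hul, List.take_left, List.drop_left]
    exact mul_ne_zero hu.1 hv.1
  · change coeffL w (x * y) = 0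
    by_cases hlen : w.length = k + l
    · rw [coeffL_mul hx]
      rw [← List.take_append_drop k w,
        append_lt_append_iff_of_length_eq (by rw [List.length_take]; omega)] at hw
      rcases hw with hw | ⟨-, hw⟩
      · rw [show coeffL (w.take k) x = 0 from hu.2 _ hw, zero_mul]
      · rw [show coeffL (w.drop k) y = 0 from hv.2 _ hw, mul_zero]
    · exact mul_mem_homog hx hy w hlen

theorem IsLeadWord.lie {k l : ℕ} {x y : WordAlg α} {u v : List α} (hx : x ∈ homog α k)
    (hy : y ∈ homog α l) (hu : IsLeadWord x u) (hv : IsLeadWord y v) (huv : u ++ v ≠ v ++ u) :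
    IsLeadWord ⁅x, y⁆ (minConcat u v) := by
  have := (hu.mul hx hy hv).sub (hv.mul hy hx hu) huv
  simp only [IsLeadWord, Ring.lie_def, map_sub]
  exact this

/-- Commutation would yield a factorization `f g` of the leading word of `y` that is the largest
shuffle of its factors, which the primitivity of `y` excludes. -/
theorem append_ne_append_of_length_lt {k l : ℕ} {x y : WordAlg α} {u v : List α}
    (hx : x ∈ lieLayer α k) (hy : y ∈ lieLayer α l) (hu : IsLeadWord x u) (hv : IsLeadWord y v)
    (hkl : k < l) : u ++ v ≠ v ++ u := by
  intro huv
  have hul := hu.length_eq (lieLayer_le_homog k hx)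
  have hvl := hv.length_eq (lieLayer_le_homog l hy)
  have hune : u ≠ [] := by
    rintro rfl
    obtain rfl : k = 0 := hul.symm
    exact hu.ne_zero (by rwa [lieLayer_zero, Submodule.mem_bot] at hx)
  obtain ⟨f, g, hf, hg, rfl, hle⟩ := exists_forall_shuffle_le huv hune (by omega)
  -- A primitive element has no component at a pair of two nonempty words.
  have h0 : (coprod α y).coeff (FreeMonoid.ofList f, FreeMonoid.ofList g) = 0 := by
    rw [coprod_of_mem_lieLayer hy, MonoidAlgebra.coeff_add, Finsupp.add_apply,
      ← MonoidAlgebra.sum_coeff_single y]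
    simp only [Finsupp.sum, map_sum, inl_single, inr_single, MonoidAlgebra.coeff_sum,
      Finsupp.finsetSum_apply, MonoidAlgebra.coeff_single]
    rw [Finset.sum_eq_zero, Finset.sum_eq_zero, add_zero]
    · exact fun w _ => Finsupp.single_eq_of_ne fun h => hf (congrArg Prod.fst h)
    · exact fun w _ => Finsupp.single_eq_of_ne fun h => hg (congrArg Prod.snd h)
  -- Every shuffle of `f` and `g` is at most `f ++ g`, and `y` has no smaller word, so `f ++ g`
  -- alone contributes. Its multiplicity is positive.
  rw [coeff_coprod, Finset.sum_eq_single (FreeMonoid.ofList (f ++ g))] at h0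
  · refine mul_ne_zero ?_ hv.1 h0
    exact Nat.cast_ne_zero.2 (List.count_pos_iff.2 (mem_splits_of_shuffle (.append f g))).ne'
  · intro w _ hw
    by_cases hmem : (f, g) ∈ splits w.toList
    · rw [show coeffL w.toList y = 0 from
        hv.2 _ (lt_of_le_of_ne (hle _ (shuffle_of_mem_splits hmem)) hw), mul_zero]
    · rw [List.count_eq_zero.2 hmem, Nat.cast_zero, zero_mul]
  · intro h
    exact absurd (Finsupp.notMem_support_iff.1 h) hv.1

theorem append_ne_append {k l : ℕ} {x y : WordAlg α} {u v : List α}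
    (hx : x ∈ lieLayer α k) (hy : y ∈ lieLayer α l) (hu : IsLeadWord x u) (hv : IsLeadWord y v)
    (hkl : k ≠ l) : u ++ v ≠ v ++ u := by
  rcases hkl.lt_or_gt with h | h
  · exact append_ne_append_of_length_lt hx hy hu hv h
  · exact (append_ne_append_of_length_lt hy hx hv hu h).symm

theorem IsLeadWord.lie_of_mem_lieLayer {k l : ℕ} {x y : WordAlg α} {u v : List α}
    (hx : x ∈ lieLayer α k) (hy : y ∈ lieLayer α l) (hu : IsLeadWord x u) (hv : IsLeadWord y v)
    (hkl : k ≠ l) : IsLeadWord ⁅x, y⁆ (minConcat u v) :=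
  hu.lie (lieLayer_le_homog k hx) (lieLayer_le_homog l hy) hv (append_ne_append hx hy hu hv hkl)

end WordAlg

end

/-! ### Functionals with nondegenerate pairings of layers -/

noncomputable section

/-- A subspace of functionals that separates the span of a linearly independent family takes all
values on this family. -/
theorem exists_dual_eq_of_linearIndependent {ι E : Type} [Finite ι] [AddCommGroup E] [Module ℝ E]
    (C : Submodule ℝ (Dual ℝ E)) {z : ι → E} (hz : LinearIndependent ℝ z)
    (hsep : ∀ x ∈ Submodule.span ℝ (Set.range z), (∀ Λ ∈ C, Λ x = 0) → x = 0) (v : ι → ℝ) :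
    ∃ Λ ∈ C, ∀ i, Λ (z i) = v i := by
  classical
  have := Fintype.ofFinite ι
  let F : Dual ℝ E →ₗ[ℝ] (ι → ℝ) := LinearMap.pi fun i => Dual.eval ℝ E (z i)
  have htop : C.map F = ⊤ := by
    -- A nonzero `f` that vanishes on the image of `C` gives the combination `∑ f(e_i) z_i`, which
    -- all of `C` annihilates. It is therefore zero, against the independence of `z`.
    by_contra hne
    obtain ⟨f, hf0, hf⟩ := Submodule.exists_le_ker_of_lt_top _ (lt_top_iff_ne_top.2 hne)
    have hfv : ∀ v : ι → ℝ, f v = ∑ i, v i * f (Pi.single i 1) := by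
      intro v
      conv_lhs => rw [pi_eq_sum_univ' v]
      rw [map_sum]
      refine Finset.sum_congr rfl fun i _ => ?_
      rw [map_smul, smul_eq_mul]
    have hx : ∑ i, f (Pi.single i 1) • z i = 0 := by
      refine hsep _ (Submodule.sum_mem _ fun i _ => Submodule.smul_mem _ _
        (Submodule.subset_span ⟨i, rfl⟩)) fun Λ hΛ => ?_
      have h := hf (Submodule.mem_map_of_mem hΛ)
      rw [LinearMap.mem_ker, hfv] at h
      rw [map_sum, ← h]
      exact Finset.sum_congr rfl fun i _ => by simp [F, mul_comm]
    have hcoef := Fintype.linearIndependent_iff.1 hz _ hx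
    refine hf0 (LinearMap.ext fun v => ?_)
    rw [hfv]
    simp [hcoef]
  obtain ⟨Λ, hΛ, h⟩ := htop.ge (Submodule.mem_top (x := v))
  exact ⟨Λ, hΛ, fun i => congrFun h i⟩

theorem det_antidiagonal_ne_zero {n : ℕ} (ε : Fin n → ℝ) (hε : ∀ i, ε i * ε i = 1) :
    (Matrix.of fun i j : Fin n => if j = Fin.rev i then ε i else 0).det ≠ 0 := by
  set M := Matrix.of fun i j : Fin n => if j = Fin.rev i then ε i else 0
  have h : M * M.transpose = 1 := by
    ext i k
    simp only [M, Matrix.mul_apply, Matrix.transpose_apply, Matrix.of_apply]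
    rw [Finset.sum_eq_single (Fin.rev i)]
    · by_cases hik : i = k
      · subst hik; simp [hε]
      · simp [hik, Fin.rev_inj]
    · intro j _ hj; simp [hj]
    · simp
  intro h0
  have := congrArg Matrix.det h
  rw [Matrix.det_mul, h0, zero_mul, Matrix.det_one] at this
  exact zero_ne_one this

namespace WordAlg

variable {α : Type}

/-- The functionals that only involve the coefficients of words of length `n`. -/
def coeffSpan (α : Type) (n : ℕ) : Submodule ℝ (Dual ℝ (WordAlg α)) :=
  Submodule.span ℝ {Λ | ∃ w : List α, w.length = n ∧ Λ = coeffL w}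

theorem eq_zero_of_forall_coeffSpan {n : ℕ} {x : WordAlg α} (hx : x ∈ homog α n)
    (h : ∀ Λ ∈ coeffSpan α n, Λ x = 0) : x = 0 := by
  refine ext_coeffL fun w => ?_
  rw [map_zero]
  by_cases hw : w.length = n
  · exact h _ (Submodule.subset_span ⟨w, hw, rfl⟩)
  · exact hx w hw

instance [Finite α] (k : ℕ) : FiniteDimensional ℝ (homog α k) := by
  have : Finite {w : List α // w.length = k} := List.finite_length_eq α k
  let F : homog α k →ₗ[ℝ] ({w : List α // w.length = k} → ℝ) :=
    LinearMap.pi fun w => coeffL w.1 ∘ₗ (homog α k).subtype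
  refine Module.Finite.of_injective F ((injective_iff_map_eq_zero F).2 fun x hx => ?_)
  refine Subtype.ext (ext_coeffL fun w => ?_)
  by_cases hw : w.length = k
  · exact (congrFun hx ⟨w, hw⟩).trans (map_zero _).symm
  · simpa using x.2 w hw

instance [Finite α] (k : ℕ) : FiniteDimensional ℝ (lieLayer α k) :=
  Submodule.finiteDimensional_of_le (lieLayer_le_homog k)

/-- Used to pass to echelon form. Invertibility of `P` and `Q` is never needed: if the product has
nonzero determinant, so does the middle factor. -/
theorem lie_congruence {n p : ℕ} (Λ : Dual ℝ (WordAlg α)) (x : Fin n → WordAlg α)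
    (y : Fin p → WordAlg α) (P : Matrix (Fin n) (Fin n) ℝ) (Q : Matrix (Fin p) (Fin p) ℝ) :
    (Matrix.of fun i j => Λ ⁅∑ a, P i a • x a, ∑ b, Q j b • y b⁆) =
      P * (Matrix.of fun a b => Λ ⁅x a, y b⁆) * Q.transpose := by
  ext i j
  simp only [Matrix.of_apply, Matrix.mul_apply, Matrix.transpose_apply, sum_lie,
    lie_sum, smul_lie, lie_smul, map_sum, map_smul, smul_eq_mul,
    Finset.sum_mul, Finset.mul_sum]
  exact Finset.sum_congr rfl fun b _ => Finset.sum_congr rfl fun a _ => by ring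

theorem lie_mem_lieLayer_succ {k : ℕ} (hk : 1 ≤ k) {x y : WordAlg α} (hx : x ∈ lieLayer α 1)
    (hy : y ∈ lieLayer α k) : ⁅x, y⁆ ∈ lieLayer α (k + 1) := by
  obtain ⟨k, rfl⟩ : ∃ l, k = l + 1 := ⟨k - 1, by omega⟩
  rw [lieLayer_add_two]
  exact Submodule.subset_span ⟨x, hx, y, hy, rfl⟩

theorem letter_mem_lieLayer (a : α) : letter a ∈ lieLayer α 1 := by
  rw [lieLayer_one]
  exact Submodule.subset_span ⟨a, rfl⟩

variable [LinearOrder α]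

theorem isLeadWord_letter (a : α) : IsLeadWord (letter a) [a] := by
  have h : ∀ w, coeffL w (letter a) = if [a] = w then 1 else 0 := fun w => coeffL_single w [a] 1
  refine ⟨?_, fun s hs => ?_⟩
  · change coeffL [a] (letter a) ≠ 0
    rw [h, if_pos rfl]
    exact one_ne_zero
  · exact (h s).trans (if_neg hs.ne')

theorem isLeadWord_lie_letter {a b : α} (hab : a < b) :
    IsLeadWord ⁅letter a, letter b⁆ [a, b] := by
  have hlt : [a] ++ [b] < [b] ++ [a] := List.cons_lt_cons_iff.2 (Or.inl hab)
  have := (isLeadWord_letter a).lie (letter_mem_homog a) (letter_mem_homog b)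
    (isLeadWord_letter b) hlt.ne
  rwa [minConcat, min_eq_left hlt.le] at this

variable [Finite α]

theorem exists_echelon_of_linearIndependent {k n : ℕ} {x : Fin n → WordAlg α}
    (hx : LinearIndependent ℝ x) (hxk : ∀ i, x i ∈ lieLayer α k) :
    ∃ (P : Matrix (Fin n) (Fin n) ℝ) (u : Fin n → List α), StrictMono u ∧
      (∀ i, ∑ a, P i a • x a ∈ lieLayer α k) ∧ ∀ i, IsLeadWord (∑ a, P i a • x a) (u i) := by
  have hle : Submodule.span ℝ (Set.range x) ≤ lieLayer α k := by
    rw [Submodule.span_le]; rintro _ ⟨i, rfl⟩; exact hxk i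
  have : FiniteDimensional ℝ (Submodule.span ℝ (Set.range x)) :=
    FiniteDimensional.span_of_finite ℝ (Set.finite_range x)
  obtain ⟨x', u, hu, hx', hlead⟩ := exists_echelon coeffL {w : List α | w.length = k}
    (List.finite_length_eq α k) n (Submodule.span ℝ (Set.range x))
    (by rw [finrank_span_eq_card hx, Fintype.card_fin])
    (fun s hs x hx => lieLayer_le_homog k (hle hx) s hs)
    (fun x _ h => ext_coeffL fun w => by rw [h, map_zero])
  choose P hP using fun i => (Submodule.mem_span_range_iff_exists_fun ℝ).1 (hx' i)
  refine ⟨Matrix.of P, u, hu, fun i => ?_, fun i => ?_⟩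
  · simpa [hP] using hle (hx' i)
  · simpa [hP] using hlead i

/-- In echelon form the leading words `minConcat (u i) (v j)` increase strictly along rows and
columns. -/
theorem exists_det_lie_ne_zero {k l n : ℕ} (hkl : k ≠ l) {x y : Fin n → WordAlg α}
    (hx : LinearIndependent ℝ x) (hxk : ∀ i, x i ∈ lieLayer α k)
    (hy : LinearIndependent ℝ y) (hyl : ∀ i, y i ∈ lieLayer α l) :
    ∃ Λ ∈ coeffSpan α (k + l), (Matrix.of fun i j => Λ ⁅x i, y j⁆).det ≠ 0 := by
  obtain ⟨P, u, hu, hxP, hPu⟩ := exists_echelon_of_linearIndependent hx hxk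
  obtain ⟨Q, v, hv, hyQ, hQv⟩ := exists_echelon_of_linearIndependent hy hyl
  have hul : ∀ i, (u i).length = k := fun i =>
    (hPu i).length_eq (lieLayer_le_homog k (hxP i))
  have hvl : ∀ i, (v i).length = l := fun i =>
    (hQv i).length_eq (lieLayer_le_homog l (hyQ i))
  obtain ⟨Λ, hΛ, hdet⟩ := exists_det_ne_zero_of_isLead coeffL n
    (fun i j => ⁅∑ a, P i a • x a, ∑ b, Q j b • y b⁆) (fun i j => minConcat (u i) (v j))
    (fun i j j' h => minConcat_lt_minConcat_right (hv h) (by rw [hvl, hvl]))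
    (fun j i i' h => by
      simp only [minConcat_comm _ (v j)]
      exact minConcat_lt_minConcat_right (hu h) (by rw [hul, hul]))
    (fun i j => (hPu i).lie_of_mem_lieLayer (hxP i) (hyQ j) (hQv j) hkl)
  refine ⟨Λ, Submodule.span_mono ?_ hΛ, ?_⟩
  · rintro _ ⟨i, j, rfl⟩
    exact ⟨_, by rw [length_minConcat, hul, hvl], rfl⟩
  · rw [lie_congruence, Matrix.det_mul, Matrix.det_mul] at hdet
    exact right_ne_zero_of_mul (left_ne_zero_of_mul hdet)

/-- Within one layer the matrix is skew and its diagonal has no leads. But the brackets with `i < j`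
have the distinct leading words `u i ++ u j`, so `Λ` can be prescribed on them; it is chosen so that
the matrix is antidiagonal. -/
theorem exists_det_lie_self_ne_zero {k n : ℕ} (hn : Even n) {x : Fin n → WordAlg α}
    (hx : LinearIndependent ℝ x) (hxk : ∀ i, x i ∈ lieLayer α k) :
    ∃ Λ ∈ coeffSpan α (k + k), (Matrix.of fun i j => Λ ⁅x i, x j⁆).det ≠ 0 := by
  obtain ⟨P, u, hu, hxP, hPu⟩ := exists_echelon_of_linearIndependent hx hxk
  have hxh : ∀ i, ∑ a, P i a • x a ∈ homog α k := fun i => lieLayer_le_homog k (hxP i)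
  have hul : ∀ i, (u i).length = k := fun i => (hPu i).length_eq (hxh i)
  set x' : Fin n → WordAlg α := fun i => ∑ a, P i a • x a with hx'
  let z : {p : Fin n × Fin n // p.1 < p.2} → WordAlg α := fun p => ⁅x' p.1.1, x' p.1.2⁆
  have hzlead : ∀ p, IsLeadWord (z p) (u p.1.1 ++ u p.1.2) := by
    intro p
    have hlt : u p.1.1 ++ u p.1.2 < u p.1.2 ++ u p.1.1 :=
      (append_lt_append_iff_of_length_eq (by rw [hul, hul])).2 (Or.inl (hu p.2))
    have := (hPu p.1.1).lie (hxh _) (hxh _) (hPu p.1.2) hlt.ne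
    rwa [minConcat, min_eq_left hlt.le] at this
  have hz : LinearIndependent ℝ z := by
    refine linearIndependent_of_isLead coeffL hzlead fun p q h => ?_
    obtain ⟨h1, h2⟩ := List.append_inj h (by rw [hul, hul])
    exact Subtype.ext (Prod.ext (hu.injective h1) (hu.injective h2))
  obtain ⟨Λ, hΛ, hval⟩ := exists_dual_eq_of_linearIndependent (coeffSpan α (k + k)) hz
    (fun y hy h => eq_zero_of_forall_coeffSpan (Submodule.span_le.2 (by
      rintro _ ⟨p, rfl⟩; exact lie_mem_homog (hxh _) (hxh _)) hy) h)
    (fun p => if p.1.2 = Fin.rev p.1.1 then 1 else 0)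
  refine ⟨Λ, hΛ, ?_⟩
  have hM : (Matrix.of fun i j => Λ ⁅x' i, x' j⁆) = Matrix.of fun i j : Fin n =>
      if j = Fin.rev i then (if i < j then (1 : ℝ) else -1) else 0 := by
    ext i j
    simp only [Matrix.of_apply]
    rcases lt_trichotomy i j with h | rfl | h
    · rw [if_pos h]
      exact hval ⟨(i, j), h⟩
    -- As `n` is even, the antidiagonal misses the diagonal.
    · rw [lie_self, map_zero, if_neg]
      intro h
      have := congrArg Fin.val h
      rw [Fin.val_rev] at this
      obtain ⟨r, hr⟩ := hn
      have := i.2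
      omega
    · rw [if_neg h.not_gt, ← lie_skew, map_neg]
      have := hval ⟨(j, i), h⟩
      simp only [z] at this
      rw [this]
      have hiff : i = Fin.rev j ↔ j = Fin.rev i :=
        ⟨fun h => by rw [h, Fin.rev_rev], fun h => by rw [h, Fin.rev_rev]⟩
      by_cases hij : j = Fin.rev i
      · rw [if_pos hij, if_pos (hiff.2 hij)]
      · rw [if_neg hij, if_neg (hiff.not.2 hij), neg_zero]
  have hdet : (Matrix.of fun i j => Λ ⁅x' i, x' j⁆).det ≠ 0 := by
    have hM' : (Matrix.of fun i j => Λ ⁅x' i, x' j⁆) = Matrix.of fun i j : Fin n =>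
        if j = Fin.rev i then (if i < Fin.rev i then (1 : ℝ) else -1) else 0 := by
      rw [hM]
      ext i j
      simp only [Matrix.of_apply]
      by_cases hij : j = Fin.rev i
      · subst hij; rfl
      · rw [if_neg hij, if_neg hij]
    rw [hM']
    exact det_antidiagonal_ne_zero _ fun i => by split_ifs <;> norm_num
  rw [hx', lie_congruence, Matrix.det_mul, Matrix.det_mul] at hdet
  exact right_ne_zero_of_mul (left_ne_zero_of_mul hdet)

/-! ### Growth of the dimensions of the layers -/

/-- Bracketing with a letter is injective on a layer of degree other than `1`, because the bracket
with a nonzero element has a leading word. -/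
theorem finrank_lieLayer_le_succ [Nonempty α] {k : ℕ} (hk : 2 ≤ k) :
    finrank ℝ (lieLayer α k) ≤ finrank ℝ (lieLayer α (k + 1)) := by
  obtain ⟨a⟩ := ‹Nonempty α›
  let F : lieLayer α k →ₗ[ℝ] lieLayer α (k + 1) :=
    ((LieAlgebra.ad ℝ (WordAlg α) (letter a) : Module.End ℝ (WordAlg α)).domRestrict _).codRestrict _
      fun x => lie_mem_lieLayer_succ (by omega) (letter_mem_lieLayer a) x.2
  refine LinearMap.finrank_le_finrank_of_injective (f := F)
    ((injective_iff_map_eq_zero F).2 fun x hx => ?_)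
  by_contra hne
  obtain ⟨u, hu⟩ := exists_isLeadWord fun h => hne (Subtype.ext h)
  exact ((isLeadWord_letter a).lie_of_mem_lieLayer (letter_mem_lieLayer a) x.2 hu
    (by omega)).ne_zero (congrArg Subtype.val hx)

theorem finrank_lieLayer_one_le (d : ℕ) : finrank ℝ (lieLayer (Fin d) 1) ≤ d := by
  rw [lieLayer_one]
  simpa [Set.finrank] using finrank_range_le_card (R := ℝ) (letter (α := Fin d))

theorem card_le_finrank_lieLayer {n k : ℕ} {x : Fin n → WordAlg α} {u : Fin n → List α}
    (hx : ∀ i, x i ∈ lieLayer α k) (hu : ∀ i, IsLeadWord (x i) (u i)) (hinj : u.Injective) :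
    n ≤ finrank ℝ (lieLayer α k) := by
  have h : LinearIndependent ℝ (fun i => (⟨x i, hx i⟩ : lieLayer α k)) :=
    LinearIndependent.of_comp (lieLayer α k).subtype
      (linearIndependent_of_isLead coeffL hu hinj)
  simpa using h.fintype_card_le_finrank

theorem finrank_lieLayer_one_le_two {d : ℕ} (hd : 3 ≤ d) :
    finrank ℝ (lieLayer (Fin d) 1) ≤ finrank ℝ (lieLayer (Fin d) 2) := by
  refine (finrank_lieLayer_one_le d).trans ?_
  obtain ⟨d, rfl⟩ : ∃ e, d = e + 3 := ⟨d - 3, by omega⟩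
  -- The brackets are `[e_0, e_j]` for `j ≠ 0`, and `[e_1, e_2]` in the slot `j = 0`.
  let s : Fin (d + 3) → Fin (d + 3) := fun j => if j = 0 then 1 else 0
  let t : Fin (d + 3) → Fin (d + 3) := fun j => if j = 0 then 2 else j
  have hst : ∀ j, s j < t j := by
    intro j
    by_cases hj : j = 0
    · simp only [s, t, if_pos hj]
      exact Fin.lt_def.2 (by simp [Nat.mod_eq_of_lt])
    · simp only [s, t, if_neg hj]
      exact Fin.pos_of_ne_zero hj
  refine card_le_finrank_lieLayer (x := fun j => ⁅letter (s j), letter (t j)⁆)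
    (u := fun j => [s j, t j])
    (fun j => lie_mem_lieLayer_succ le_rfl (letter_mem_lieLayer _) (letter_mem_lieLayer _))
    (fun j => isLeadWord_lie_letter (hst j)) fun i j hij => ?_
  simp only [List.cons.injEq, and_true, s, t] at hij
  split_ifs at hij <;> simp_all

theorem finrank_lieLayer_one_le_three {d : ℕ} (hd : 2 ≤ d) :
    finrank ℝ (lieLayer (Fin d) 1) ≤ finrank ℝ (lieLayer (Fin d) 3) := by
  refine (finrank_lieLayer_one_le d).trans ?_
  obtain ⟨d, rfl⟩ : ∃ e, d = e + 2 := ⟨d - 2, by omega⟩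
  -- The elements are `[e_j, [e_0, e_j]]` for `j ≠ 0` and `[e_0, [e_0, e_1]]` for `j = 0`, with
  -- leading words `0jj` and `001`.
  let t : Fin (d + 2) → Fin (d + 2) := fun j => if j = 0 then 1 else j
  have ht : ∀ j, 0 < t j := by
    intro j
    refine Fin.pos_of_ne_zero ?_
    by_cases hj : j = 0 <;> simp [t, hj]
  have hlie : ∀ j, ⁅letter (0 : Fin (d + 2)), letter (t j)⁆ ∈ lieLayer (Fin (d + 2)) 2 := fun j =>
    lie_mem_lieLayer_succ le_rfl (letter_mem_lieLayer _) (letter_mem_lieLayer _)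
  refine card_le_finrank_lieLayer (x := fun j => ⁅letter j, ⁅letter (0 : Fin (d + 2)), letter (t j)⁆⁆)
    (u := fun j => minConcat [j] [0, t j])
    (fun j => lie_mem_lieLayer_succ (by omega) (letter_mem_lieLayer _) (hlie j))
    (fun j => (isLeadWord_letter j).lie_of_mem_lieLayer (letter_mem_lieLayer _) (hlie j)
      (isLeadWord_lie_letter (ht j)) (by norm_num)) ?_
  have hu : ∀ j, minConcat [j] [0, t j] = if j = 0 then [0, 0, 1] else [0, j, j] := by
    intro j
    by_cases hj : j = 0
    · subst hj
      rw [if_pos rfl, minConcat, min_eq_left]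
      · rfl
      · exact (List.cons_lt_cons_iff.2 (Or.inr ⟨rfl, List.cons_lt_cons_iff.2 (Or.inl (ht 0))⟩)).le
    · rw [if_neg hj, minConcat, min_eq_right]
      · simp [t, hj]
      · exact (List.cons_lt_cons_iff.2 (Or.inl (Fin.pos_of_ne_zero hj))).le
  intro i j hij
  simp only [hu] at hij
  split_ifs at hij <;> simp_all

end WordAlg

end

/-! ### Transfer to the truncated tensor algebra -/

noncomputable section

namespace WordAlg

variable {α : Type}

/-- The elements all of whose words have length at least `n`. -/
def order (α : Type) (n : ℕ) : Submodule ℝ (WordAlg α) where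
  carrier := {x | ∀ w : List α, w.length < n → coeffL w x = 0}
  zero_mem' w _ := map_zero _
  add_mem' hx hy w hw := by rw [map_add, hx w hw, hy w hw, add_zero]
  smul_mem' r x hx w hw := by rw [map_smul, hx w hw, smul_zero]

theorem mul_mem_order {k l : ℕ} {x y : WordAlg α} (hx : x ∈ order α k) (hy : y ∈ order α l) :
    x * y ∈ order α (k + l) := by
  classical
  intro w hw
  rw [coeffL_apply, MonoidAlgebra.coeff_mul]
  refine Finset.sum_eq_zero fun u hu => Finset.sum_eq_zero fun v hv => if_neg fun h => ?_
  have h' : u.toList ++ v.toList = w := h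
  have hu' : k ≤ u.toList.length := by
    by_contra h
    exact Finsupp.mem_support_iff.1 hu (hx u.toList (not_le.1 h))
  have hv' : l ≤ v.toList.length := by
    by_contra h
    exact Finsupp.mem_support_iff.1 hv (hy v.toList (not_le.1 h))
  rw [← h', List.length_append] at hw
  omega

/-- The projection to the coefficient of the empty word. -/
def counit (α : Type) : WordAlg α →ₐ[ℝ] ℝ := MonoidAlgebra.lift ℝ _ _ (FreeMonoid.lift fun _ => 0)

theorem coeffL_nil (x : WordAlg α) : coeffL [] x = counit α x := by
  classical
  induction x using MonoidAlgebra.induction_linear with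
  | zero => simp
  | add f g hf hg => rw [map_add, map_add, hf, hg]
  | single u r =>
    rw [show u = FreeMonoid.ofList u.toList from rfl, coeffL_single, counit,
      MonoidAlgebra.lift_single]
    cases u.toList with
    | nil => simp
    | cons a w => simp [FreeMonoid.ofList_cons]

/-- Induction on `k` by the Jacobi identity, which moves one letter at a time to the outside or into
`y`. -/
theorem lie_mem_lieLayer {k l : ℕ} (hl : 1 ≤ l) {x y : WordAlg α} (hx : x ∈ lieLayer α k)
    (hy : y ∈ lieLayer α l) : ⁅x, y⁆ ∈ lieLayer α (k + l) := by
  induction k using Nat.strong_induction_on generalizing x y l with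
  | _ k ih =>
    match k, ih with
    | 0, _ =>
      rw [lieLayer_zero, Submodule.mem_bot] at hx
      rw [hx, zero_lie]
      exact Submodule.zero_mem _
    | 1, _ => rw [add_comm]; exact lie_mem_lieLayer_succ hl hx hy
    | k + 2, ih =>
      rw [lieLayer_add_two] at hx
      induction hx using Submodule.span_induction with
      | mem x h =>
        obtain ⟨a, ha, z, hz, rfl⟩ := h
        rw [lie_lie]
        refine Submodule.sub_mem _ ?_ ?_
        · have := lie_mem_lieLayer_succ (by omega) ha (ih (k + 1) (by omega) hl hz hy)
          rwa [show k + 1 + l + 1 = k + 2 + l by omega] at this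
        · have := ih (k + 1) (by omega) (by omega) hz (lie_mem_lieLayer_succ hl ha hy)
          rwa [show k + 1 + (l + 1) = k + 2 + l by omega] at this
      | zero => rw [zero_lie]; exact Submodule.zero_mem _
      | add x x' _ _ hx hx' => rw [add_lie]; exact Submodule.add_mem _ hx hx'
      | smul r x _ hx => rw [smul_lie]; exact Submodule.smul_mem _ r hx

end WordAlg

open WordAlg

section Transfer

variable {N d : ℕ}

/-- The expansion of a tensor into words in the standard basis. -/
def tensorToWord (d : ℕ) : TensorAlgebra ℝ (Fin d → ℝ) →ₐ[ℝ] WordAlg (Fin d) :=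
  TensorAlgebra.lift ℝ (Fintype.linearCombination ℝ letter)

def wordToTensor (d : ℕ) : WordAlg (Fin d) →ₐ[ℝ] TensorAlgebra ℝ (Fin d → ℝ) :=
  MonoidAlgebra.lift ℝ _ _ (FreeMonoid.lift fun i => TensorAlgebra.ι ℝ (Pi.single i 1))

theorem wordToTensor_letter (i : Fin d) :
    wordToTensor d (letter i) = TensorAlgebra.ι ℝ (Pi.single i 1) := by
  simp only [wordToTensor, letter, MonoidAlgebra.lift_single, FreeMonoid.lift_eval_of, one_smul]

theorem tensorToWord_wordToTensor (x : WordAlg (Fin d)) :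
    tensorToWord d (wordToTensor d x) = x := by
  have h : (tensorToWord d).comp (wordToTensor d) = AlgHom.id ℝ _ := by
    refine (MonoidAlgebra.lift ℝ _ _).symm.injective (FreeMonoid.hom_eq fun i => ?_)
    change tensorToWord d (wordToTensor d (letter i)) = letter i
    rw [wordToTensor_letter, tensorToWord, TensorAlgebra.lift_ι_apply,
      Fintype.linearCombination_apply_single, one_smul]
  exact DFunLike.congr_fun h x

/-- The augmentation ideal of the tensor algebra. -/
abbrev augIdeal (d : ℕ) : Ideal (TensorAlgebra ℝ (Fin d → ℝ)) :=
  RingHom.ker (TensorAlgebra.algebraMapInv (R := ℝ) (M := Fin d → ℝ))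

theorem counit_tensorToWord (x : TensorAlgebra ℝ (Fin d → ℝ)) :
    counit (Fin d) (tensorToWord d x) = TensorAlgebra.algebraMapInv x := by
  have h : (counit (Fin d)).comp (tensorToWord d) = TensorAlgebra.algebraMapInv := by
    refine TensorAlgebra.hom_ext (LinearMap.ext fun v => ?_)
    simp [tensorToWord, TensorAlgebra.algebraMapInv, Fintype.linearCombination_apply, counit,
      letter, MonoidAlgebra.lift_single]
  exact DFunLike.congr_fun h x

theorem tensorToWord_mem_order {n : ℕ} {x : TensorAlgebra ℝ (Fin d → ℝ)}
    (hx : x ∈ augIdeal d ^ n) : tensorToWord d x ∈ order (Fin d) n := by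
  induction n generalizing x with
  | zero => exact fun w hw => absurd hw (by simp)
  | succ n ih =>
    rw [Submodule.pow_succ] at hx
    refine Submodule.smul_induction_on hx (fun r hr y hy => ?_) fun y z hy hz => ?_
    · rw [smul_eq_mul, map_mul]
      refine mul_mem_order (ih hr) fun w hw => ?_
      obtain rfl : w = [] := List.length_eq_zero_iff.1 (by omega)
      rw [coeffL_nil, counit_tensorToWord]
      exact hy
    · rw [map_add]; exact Submodule.add_mem _ hy hz

theorem wordToTensor_mem_pow {k : ℕ} {x : WordAlg (Fin d)} (hx : x ∈ homog (Fin d) k) :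
    wordToTensor d x ∈ augIdeal d ^ k := by
  have hword : ∀ w : List (Fin d), wordToTensor d (MonoidAlgebra.single (FreeMonoid.ofList w) 1) ∈
      augIdeal d ^ w.length := by
    intro w
    induction w with
    | nil => rw [List.length_nil, Submodule.pow_zero, Ideal.one_eq_top]; exact Submodule.mem_top
    | cons a w ih =>
      have h : (MonoidAlgebra.single (FreeMonoid.ofList (a :: w)) 1 : WordAlg (Fin d)) =
          letter a * MonoidAlgebra.single (FreeMonoid.ofList w) 1 := by
        rw [letter, MonoidAlgebra.single_mul_single, one_mul]; rfl
      rw [h, map_mul, List.length_cons, Ideal.IsTwoSided.pow_succ]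
      refine Ideal.mul_mem_mul ?_ ih
      rw [wordToTensor_letter, RingHom.mem_ker]
      simp [TensorAlgebra.algebraMapInv]
  have hsum : x = ∑ u ∈ x.coeff.support, x.coeff u • MonoidAlgebra.single u (1 : ℝ) := by
    conv_lhs => rw [← MonoidAlgebra.sum_coeff_single x]
    simp [Finsupp.sum]
  rw [hsum, map_sum]
  refine Submodule.sum_mem _ fun u hu => ?_
  have hlen : u.toList.length = k := by
    by_contra h
    exact Finsupp.mem_support_iff.1 hu (hx u.toList h)
  rw [map_smul, Algebra.smul_def]
  have := hword u.toList
  rw [hlen] at this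
  exact Ideal.mul_mem_left _ _ this

/-- The evaluation of words in the truncated tensor algebra. -/
def wordEval (N d : ℕ) : WordAlg (Fin d) →ₐ[ℝ] TruncTensor N d :=
  (TruncTensor.mk N d).comp (wordToTensor d)

theorem wordEval_letter (i : Fin d) :
    wordEval N d (letter i) = TruncTensor.gen N d (Pi.single i 1) := by
  change TruncTensor.mk N d (wordToTensor d (letter i)) = _
  rw [wordToTensor_letter]
  rfl

theorem mk_eq_zero_iff (x : TensorAlgebra ℝ (Fin d → ℝ)) :
    TruncTensor.mk N d x = 0 ↔ x ∈ augIdeal d ^ (N + 1) :=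
  Ideal.Quotient.eq_zero_iff_mem

theorem mk_surjective : Function.Surjective (TruncTensor.mk N d) :=
  Ideal.Quotient.mk_surjective

theorem wordEval_eq_zero {k : ℕ} (hk : N < k) {x : WordAlg (Fin d)} (hx : x ∈ homog (Fin d) k) :
    wordEval N d x = 0 := by
  refine (mk_eq_zero_iff _).2 (Ideal.pow_le_pow_right hk (wordToTensor_mem_pow hx))

/-- `Λ` reads only words of length `n ≤ N`, and the elements of the ideal consist of longer words,
so `Λ` descends to the quotient. -/
theorem exists_dual_truncTensor {n : ℕ} (hn : n ≤ N) {Λ : Dual ℝ (WordAlg (Fin d))}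
    (hΛ : Λ ∈ coeffSpan (Fin d) n) :
    ∃ ℓ : Dual ℝ (TruncTensor N d), ∀ x, ℓ (wordEval N d x) = Λ x := by
  obtain ⟨s, hs⟩ := (TruncTensor.mk N d).toLinearMap.exists_rightInverse_of_surjective
    (LinearMap.range_eq_top.2 mk_surjective)
  have hker : ∀ x ∈ augIdeal d ^ (N + 1), Λ (tensorToWord d x) = 0 := by
    intro x hx
    have h := tensorToWord_mem_order hx
    induction hΛ using Submodule.span_induction with
    | mem Λ hΛ =>
      obtain ⟨w, hw, rfl⟩ := hΛ
      exact h w (by omega)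
    | zero => rfl
    | add Λ Λ' _ _ h₁ h₂ => rw [LinearMap.add_apply, h₁, h₂, add_zero]
    | smul r Λ _ h₁ => rw [LinearMap.smul_apply, h₁, smul_zero]
  refine ⟨Λ ∘ₗ (tensorToWord d).toLinearMap ∘ₗ s, fun x => ?_⟩
  have h0 : TruncTensor.mk N d (s (wordEval N d x) - wordToTensor d x) = 0 := by
    rw [map_sub, sub_eq_zero]
    exact LinearMap.congr_fun hs (wordEval N d x)
  have h1 := hker _ ((mk_eq_zero_iff _).1 h0)
  rw [map_sub, map_sub, tensorToWord_wordToTensor, sub_eq_zero] at h1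
  exact h1

theorem wordEval_injOn {k : ℕ} (hk : k ≤ N) {x : WordAlg (Fin d)} (hx : x ∈ homog (Fin d) k)
    (h : wordEval N d x = 0) : x = 0 := by
  refine eq_zero_of_forall_coeffSpan hx fun Λ hΛ => ?_
  obtain ⟨ℓ, hℓ⟩ := exists_dual_truncTensor hk hΛ
  rw [← hℓ, h, map_zero]

theorem wordEval_lie (x y : WordAlg (Fin d)) :
    wordEval N d ⁅x, y⁆ = ⁅wordEval N d x, wordEval N d y⁆ := by
  change wordEval N d (x * y - y * x) = _ * _ - _ * _
  rw [map_sub, map_mul, map_mul]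

theorem layer_zero : layer N d 0 = ⊥ := by rw [layer]

theorem layer_one : layer N d 1 =
    (LinearMap.range (TruncTensor.gen N d)).comap (FreeNilp N d).toSubmodule.subtype := by
  rw [layer]

theorem layer_add_two (k : ℕ) : layer N d (k + 2) = Submodule.span ℝ
    {z | ∃ x ∈ layer N d 1, ∃ y ∈ layer N d (k + 1), z = ⁅x, y⁆} := by
  conv_lhs => rw [layer]

theorem map_wordEval_lieLayer_one :
    (lieLayer (Fin d) 1).map (wordEval N d).toLinearMap = LinearMap.range (TruncTensor.gen N d) := by
  rw [lieLayer_one, Submodule.map_span, ← Set.range_comp]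
  have h : ⇑(wordEval N d).toLinearMap ∘ letter =
      ⇑(TruncTensor.gen N d) ∘ fun i : Fin d => Pi.single i (1 : ℝ) :=
    funext fun i => wordEval_letter i
  rw [h, Set.range_comp, ← Submodule.map_span]
  have := (Pi.basisFun ℝ (Fin d)).span_eq
  have hb : ⇑(Pi.basisFun ℝ (Fin d)) = fun i : Fin d => Pi.single i (1 : ℝ) :=
    funext fun i => Pi.basisFun_apply ℝ _ i
  rw [hb] at this
  rw [this, Submodule.map_top]

/-- The layers of the free nilpotent Lie algebra are the images of those of the free one. -/
theorem map_layer (k : ℕ) : (layer N d k).map (FreeNilp N d).toSubmodule.subtype =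
    (lieLayer (Fin d) k).map (wordEval N d).toLinearMap := by
  induction k using Nat.strong_induction_on with
  | _ k ih =>
    match k, ih with
    | 0, _ => rw [layer_zero, lieLayer_zero, Submodule.map_bot, Submodule.map_bot]
    | 1, _ =>
      rw [layer_one, map_wordEval_lieLayer_one, Submodule.map_comap_subtype, inf_eq_right]
      rintro _ ⟨v, rfl⟩
      exact LieSubalgebra.subset_lieSpan ⟨v, rfl⟩
    | k + 2, ih =>
      rw [layer_add_two, lieLayer_add_two, Submodule.map_span, Submodule.map_span]
      have h1 := ih 1 (by omega)
      have h2 := ih (k + 1) (by omega)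
      congr 1
      ext z
      constructor
      · rintro ⟨_, ⟨x, hx, y, hy, rfl⟩, rfl⟩
        obtain ⟨x', hx', hxx⟩ := h1.le (Submodule.mem_map_of_mem hx)
        obtain ⟨y', hy', hyy⟩ := h2.le (Submodule.mem_map_of_mem hy)
        refine ⟨_, ⟨x', hx', y', hy', rfl⟩, ?_⟩
        refine (wordEval_lie x' y').trans ?_
        exact congrArg₂ _ hxx hyy
      · rintro ⟨_, ⟨x, hx, y, hy, rfl⟩, rfl⟩
        obtain ⟨x', hx', hxx⟩ := h1.ge (Submodule.mem_map_of_mem hx)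
        obtain ⟨y', hy', hyy⟩ := h2.ge (Submodule.mem_map_of_mem hy)
        refine ⟨_, ⟨x', hx', y', hy', rfl⟩, ?_⟩
        exact (congrArg₂ (fun a b : TruncTensor N d => ⁅a, b⁆) hxx hyy).trans
          (wordEval_lie x y).symm

theorem exists_wordEval_eq {k : ℕ} {x : FreeNilp N d} (hx : x ∈ layer N d k) :
    ∃ y ∈ lieLayer (Fin d) k, wordEval N d y = x :=
  (map_layer k).le (Submodule.mem_map_of_mem hx)

theorem mem_layer_of_wordEval_eq {k : ℕ} {x : FreeNilp N d} {y : WordAlg (Fin d)}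
    (hy : y ∈ lieLayer (Fin d) k) (h : wordEval N d y = x) : x ∈ layer N d k := by
  obtain ⟨x', hx', hxx⟩ := (map_layer (N := N) k).ge (Submodule.mem_map_of_mem hy)
  obtain rfl : x' = x := Subtype.ext (hxx.trans h)
  exact hx'

theorem lie_mem_layer {k l : ℕ} (hl : 1 ≤ l) {x y : FreeNilp N d} (hx : x ∈ layer N d k)
    (hy : y ∈ layer N d l) : ⁅x, y⁆ ∈ layer N d (k + l) := by
  obtain ⟨x', hx', hxx⟩ := exists_wordEval_eq hx
  obtain ⟨y', hy', hyy⟩ := exists_wordEval_eq hy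
  refine mem_layer_of_wordEval_eq (lie_mem_lieLayer hl hx' hy') ?_
  rw [wordEval_lie, hxx, hyy]
  rfl

theorem layer_eq_bot {k : ℕ} (hk : N < k) : layer N d k = ⊥ := by
  refine (Submodule.eq_bot_iff _).2 fun x hx => ?_
  obtain ⟨y, hy, hyx⟩ := exists_wordEval_eq hx
  exact Subtype.ext (hyx.symm.trans (wordEval_eq_zero hk (lieLayer_le_homog k hy)))

theorem finrank_layer {k : ℕ} (hk : k ≤ N) :
    finrank ℝ (layer N d k) = finrank ℝ (lieLayer (Fin d) k) := by
  have h1 := LinearEquiv.finrank_eq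
    (Submodule.equivMapOfInjective (FreeNilp N d).toSubmodule.subtype
      (FreeNilp N d).toSubmodule.injective_subtype (layer N d k))
  have hinj : Function.Injective ((wordEval N d).toLinearMap.domRestrict (lieLayer (Fin d) k)) :=
    (injective_iff_map_eq_zero _).2 fun x hx =>
      Subtype.ext (wordEval_injOn hk (lieLayer_le_homog k x.2) hx)
  have h2 := LinearMap.finrank_range_of_inj hinj
  rw [LinearMap.range_domRestrict] at h2
  rw [← h2, ← map_layer]
  exact h1

theorem exists_linearIndependent_lift {k n : ℕ} {x : Fin n → FreeNilp N d}
    (hx : LinearIndependent ℝ x) (hxk : ∀ i, x i ∈ layer N d k) :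
    ∃ y : Fin n → WordAlg (Fin d), LinearIndependent ℝ y ∧ (∀ i, y i ∈ lieLayer (Fin d) k) ∧
      ∀ i, wordEval N d (y i) = x i := by
  choose y hy hyx using fun i => exists_wordEval_eq (hxk i)
  refine ⟨y, LinearIndependent.of_comp (wordEval N d).toLinearMap ?_, hy, hyx⟩
  have h : ⇑(wordEval N d).toLinearMap ∘ y = ⇑(FreeNilp N d).toSubmodule.subtype ∘ x :=
    funext hyx
  rw [h]
  exact hx.map' _ (Submodule.ker_subtype _)

theorem exists_dual_freeNilp {n : ℕ} (hn : n ≤ N) {Λ : Dual ℝ (WordAlg (Fin d))}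
    (hΛ : Λ ∈ coeffSpan (Fin d) n) : ∃ ℓ : Dual ℝ (FreeNilp N d), ∀ (x y : FreeNilp N d)
      (x' y' : WordAlg (Fin d)), wordEval N d x' = x → wordEval N d y' = y →
        ℓ ⁅x, y⁆ = Λ ⁅x', y'⁆ := by
  obtain ⟨ℓ, hℓ⟩ := exists_dual_truncTensor hn hΛ
  refine ⟨ℓ ∘ₗ (FreeNilp N d).toSubmodule.subtype, fun x y x' y' hx hy => ?_⟩
  rw [← hℓ, wordEval_lie, hx, hy]
  rfl

theorem exists_dual_det_lie_ne_zero {k l n : ℕ} (hkl : k ≠ l) (hN : k + l ≤ N)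
    {x y : Fin n → FreeNilp N d} (hx : LinearIndependent ℝ x) (hxk : ∀ i, x i ∈ layer N d k)
    (hy : LinearIndependent ℝ y) (hyl : ∀ i, y i ∈ layer N d l) :
    ∃ ℓ : Dual ℝ (FreeNilp N d), (Matrix.of fun i j => ℓ ⁅x i, y j⁆).det ≠ 0 := by
  obtain ⟨x', hx', hxk', hxx⟩ := exists_linearIndependent_lift hx hxk
  obtain ⟨y', hy', hyl', hyy⟩ := exists_linearIndependent_lift hy hyl
  obtain ⟨Λ, hΛ, hdet⟩ := exists_det_lie_ne_zero hkl hx' hxk' hy' hyl'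
  obtain ⟨ℓ, hℓ⟩ := exists_dual_freeNilp hN hΛ
  refine ⟨ℓ, ?_⟩
  simp only [hℓ _ _ _ _ (hxx _) (hyy _)]
  exact hdet

theorem exists_dual_det_lie_self_ne_zero {k n : ℕ} (hn : Even n) (hN : k + k ≤ N)
    {x : Fin n → FreeNilp N d} (hx : LinearIndependent ℝ x) (hxk : ∀ i, x i ∈ layer N d k) :
    ∃ ℓ : Dual ℝ (FreeNilp N d), (Matrix.of fun i j => ℓ ⁅x i, x j⁆).det ≠ 0 := by
  obtain ⟨x', hx', hxk', hxx⟩ := exists_linearIndependent_lift hx hxk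
  obtain ⟨Λ, hΛ, hdet⟩ := exists_det_lie_self_ne_zero hn hx' hxk'
  obtain ⟨ℓ, hℓ⟩ := exists_dual_freeNilp hN hΛ
  refine ⟨ℓ, ?_⟩
  simp only [hℓ _ _ _ _ (hxx _) (hxx _)]
  exact hdet

/-- Dimensions grow from the second layer on, so only the first layer needs a separate comparison,
with the second or the third. The exclusion is genuine: for `d = 2` the second layer is a line. -/
theorem finrank_layer_le {k l : ℕ} (hd : 2 ≤ d) (hex : ¬ (k + l = 3 ∧ d = 2)) (hkl : k < l)
    (hN : l ≤ N) : finrank ℝ (layer N d k) ≤ finrank ℝ (layer N d l) := by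
  have : Nonempty (Fin d) := ⟨⟨0, by omega⟩⟩
  rw [finrank_layer (by omega), finrank_layer hN]
  have mono : ∀ {i j : ℕ}, 2 ≤ i → i ≤ j →
      finrank ℝ (lieLayer (Fin d) i) ≤ finrank ℝ (lieLayer (Fin d) j) := by
    intro i j hi hij
    induction j, hij using Nat.le_induction with
    | base => exact le_rfl
    | succ j hij ih => exact ih.trans (finrank_lieLayer_le_succ (by omega))
  match k with
  | 0 => rw [lieLayer_zero]; simp
  | 1 =>
    rcases (show 2 ≤ l by omega).eq_or_lt with rfl | hl
    · exact finrank_lieLayer_one_le_two (by omega)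
    · exact (finrank_lieLayer_one_le_three hd).trans (mono (by omega) hl)
  | k + 2 => exact mono (by omega) hkl.le

end Transfer

end

/-! ### Indices of layer-adapted bases -/

noncomputable section

namespace LayerIndex

variable {N : ℕ} {m : ℕ → ℕ}

theorem layer_mem (j : LayerIndex N m) : j.layer ∈ Finset.Icc 1 N :=
  (OrderDual.ofDual (ofLex j).1).2

theorem one_le_layer (j : LayerIndex N m) : 1 ≤ j.layer := (Finset.mem_Icc.1 j.layer_mem).1

theorem layer_le (j : LayerIndex N m) : j.layer ≤ N := (Finset.mem_Icc.1 j.layer_mem).2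

theorem one_le_pos (j : LayerIndex N m) : 1 ≤ j.pos := Nat.succ_pos _

theorem pos_le (j : LayerIndex N m) : j.pos ≤ m j.layer := (ofLex j).2.2

@[simp] theorem layer_mk (k : ℕ) (hk : k ∈ Finset.Icc 1 N) (i : Fin (m k)) :
    (mk k hk i : LayerIndex N m).layer = k := rfl

@[simp] theorem pos_mk (k : ℕ) (hk : k ∈ Finset.Icc 1 N) (i : Fin (m k)) :
    (mk k hk i : LayerIndex N m).pos = i + 1 := rfl

theorem exists_eq_mk (j : LayerIndex N m) :
    ∃ (k : ℕ) (hk : k ∈ Finset.Icc 1 N) (i : Fin (m k)), j = mk k hk i :=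
  ⟨j.layer, j.layer_mem, (ofLex j).2, rfl⟩

theorem mk_injective (k : ℕ) (hk : k ∈ Finset.Icc 1 N) :
    Function.Injective (mk k hk : Fin (m k) → LayerIndex N m) := by
  intro i j h
  have := congrArg pos h
  simp only [pos_mk] at this
  exact Fin.ext (by omega)

theorem le_iff {i j : LayerIndex N m} :
    i ≤ j ↔ j.layer < i.layer ∨ i.layer = j.layer ∧ i.pos ≤ j.pos := by
  obtain ⟨k, hk, p, rfl⟩ := i.exists_eq_mk
  obtain ⟨l, hl, q, rfl⟩ := j.exists_eq_mk
  rw [show (mk k hk p : LayerIndex N m) ≤ mk l hl q ↔ _ from Sigma.Lex.le_def]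
  simp only [layer_mk, pos_mk]
  constructor
  · rintro (h | ⟨h, h'⟩)
    · exact Or.inl h
    · obtain rfl : k = l := congrArg (fun x => ((OrderDual.ofDual x : Finset.Icc 1 N) : ℕ)) h
      exact Or.inr ⟨rfl, Nat.succ_le_succ h'⟩
  · rintro (h | ⟨rfl, h⟩)
    · exact Or.inl h
    · exact Or.inr ⟨rfl, Nat.le_of_succ_le_succ h⟩

theorem exists_eq_mk_of_layer_eq {j : LayerIndex N m} {k : ℕ} (h : j.layer = k)
    (hk : k ∈ Finset.Icc 1 N) : ∃ i : Fin (m k), j = mk k hk i := by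
  subst h
  exact ⟨(ofLex j).2, rfl⟩

theorem card_layer_eq {k : ℕ} (hk : k ∈ Finset.Icc 1 N) :
    (Finset.univ.filter fun j : LayerIndex N m => j.layer = k).card = m k := by
  rw [show (Finset.univ.filter fun j : LayerIndex N m => j.layer = k) =
    Finset.univ.map ⟨mk k hk, mk_injective k hk⟩ from ?_, Finset.card_map, Finset.card_fin]
  ext j
  simp only [Finset.mem_filter, Finset.mem_univ, true_and, Finset.mem_map,
    Function.Embedding.coeFn_mk]
  constructor
  · intro h
    obtain ⟨i, rfl⟩ := exists_eq_mk_of_layer_eq h hk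
    exact ⟨i, rfl⟩
  · rintro ⟨i, rfl⟩
    rfl

theorem card_layer_mem {s : Finset ℕ} (hs : s ⊆ Finset.Icc 1 N) :
    (Finset.univ.filter fun j : LayerIndex N m => j.layer ∈ s).card = ∑ k ∈ s, m k := by
  rw [Finset.card_eq_sum_card_fiberwise (f := layer) (t := s) fun j hj => by simpa using hj]
  refine Finset.sum_congr rfl fun k hk => ?_
  refine Eq.trans ?_ (card_layer_eq (hs hk))
  rw [Finset.filter_filter]
  congr 1
  ext j
  simp only [Finset.mem_filter, Finset.mem_univ, true_and, and_iff_right_iff_imp]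
  rintro rfl
  exact hk

end LayerIndex

/-! ### The filtration by layers and the adjoint action -/

section Filtration

variable {N d : ℕ} {m : ℕ → ℕ} {b : Basis (LayerIndex N m) ℝ (FreeNilp N d)}

theorem IsLayerAdapted.mem_layer (hb : IsLayerAdapted b) (i : LayerIndex N m) :
    b i ∈ layer N d i.layer := by
  obtain ⟨k, hk, p, rfl⟩ := i.exists_eq_mk
  rw [LayerIndex.layer_mk, ← hb k hk]
  exact Submodule.subset_span ⟨p, rfl⟩

theorem IsLayerAdapted.finrank_layer_eq (hb : IsLayerAdapted b) {k : ℕ}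
    (hk : k ∈ Finset.Icc 1 N) : finrank ℝ (layer N d k) = m k := by
  rw [← hb k hk]
  exact (finrank_span_eq_card (b.linearIndependent.comp _ (LayerIndex.mk_injective k hk))).trans
    (Fintype.card_fin _)

theorem layerVec_eq {k i : ℕ} (hk : k ∈ Finset.Icc 1 N) (hi : i < m k) :
    layerVec b k i = b (LayerIndex.mk k hk ⟨i, hi⟩) := dif_pos ⟨hk, hi⟩

theorem layerVec_eq_zero {k i : ℕ} (hi : m k ≤ i) : layerVec b k i = 0 :=
  dif_neg fun h => absurd h.2 (not_lt.2 hi)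

theorem basis_eq_layerVec (i : LayerIndex N m) : b i = layerVec b i.layer (i.pos - 1) := by
  obtain ⟨k, hk, p, rfl⟩ := i.exists_eq_mk
  rw [LayerIndex.layer_mk, LayerIndex.pos_mk, Nat.add_sub_cancel, layerVec_eq hk p.2]

variable (b) in
/-- The span of the basis vectors in the layers from the `p`-th one on. -/
def deepLayers (p : ℕ) : Submodule ℝ (FreeNilp N d) :=
  Submodule.span ℝ (b '' {i | p ≤ i.layer})

theorem mem_deepLayers {p : ℕ} {i : LayerIndex N m} (h : p ≤ i.layer) : b i ∈ deepLayers b p :=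
  Submodule.subset_span ⟨i, h, rfl⟩

theorem deepLayers_anti {p q : ℕ} (h : p ≤ q) : deepLayers b q ≤ deepLayers b p :=
  Submodule.span_mono (Set.image_mono fun _ hi => le_trans h hi)

theorem deepLayers_eq_bot {p : ℕ} (hp : N < p) : deepLayers b p = ⊥ := by
  rw [deepLayers, Submodule.span_eq_bot]
  rintro _ ⟨i, hi, rfl⟩
  exact absurd i.layer_le (not_le.2 (lt_of_lt_of_le hp hi))

theorem mem_deepLayers_one (x : FreeNilp N d) : x ∈ deepLayers b 1 := by
  have h : {i : LayerIndex N m | 1 ≤ i.layer} = Set.univ :=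
    Set.eq_univ_of_forall fun i => i.one_le_layer
  rw [deepLayers, h, Set.image_univ, b.span_eq]
  exact Submodule.mem_top

theorem IsLayerAdapted.layer_le_deepLayers (hb : IsLayerAdapted b) {k : ℕ} (hk : 1 ≤ k) :
    layer N d k ≤ deepLayers b k := by
  rcases le_or_gt k N with h | h
  · rw [← hb k (Finset.mem_Icc.2 ⟨hk, h⟩), Submodule.span_le]
    rintro _ ⟨i, rfl⟩
    exact mem_deepLayers le_rfl
  · rw [layer_eq_bot h]
    exact bot_le

theorem IsLayerAdapted.lie_mem_deepLayers (hb : IsLayerAdapted b) {p q : ℕ} {x y : FreeNilp N d}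
    (hx : x ∈ deepLayers b p) (hy : y ∈ deepLayers b q) : ⁅x, y⁆ ∈ deepLayers b (p + q) := by
  induction hx using Submodule.span_induction with
  | mem x h =>
    obtain ⟨i, hi, rfl⟩ := h
    induction hy using Submodule.span_induction with
    | mem y h =>
      obtain ⟨j, hj, rfl⟩ := h
      refine deepLayers_anti (Nat.add_le_add hi hj) (hb.layer_le_deepLayers ?_
        (lie_mem_layer j.one_le_layer (hb.mem_layer i) (hb.mem_layer j)))
      have := i.one_le_layer
      omega
    | zero => rw [lie_zero]; exact Submodule.zero_mem _
    | add y y' _ _ hy hy' => rw [lie_add]; exact Submodule.add_mem _ hy hy'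
    | smul r y _ hy => rw [lie_smul]; exact Submodule.smul_mem _ r hy
  | zero => rw [zero_lie]; exact Submodule.zero_mem _
  | add x x' _ _ hx hx' => rw [add_lie]; exact Submodule.add_mem _ hx hx'
  | smul r x _ hx => rw [smul_lie]; exact Submodule.smul_mem _ r hx

theorem IsLayerAdapted.lie_eq_zero (hb : IsLayerAdapted b) {p q : ℕ} {x y : FreeNilp N d}
    (hx : x ∈ deepLayers b p) (hy : y ∈ deepLayers b q) (h : N < p + q) : ⁅x, y⁆ = 0 := by
  have := hb.lie_mem_deepLayers hx hy
  rwa [deepLayers_eq_bot h, Submodule.mem_bot] at this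

theorem ad_pow_succ_apply (X v : FreeNilp N d) (k : ℕ) :
    (LieAlgebra.ad ℝ (FreeNilp N d) X ^ (k + 1)) v =
      (LieAlgebra.ad ℝ (FreeNilp N d) X ^ k) ⁅X, v⁆ := by
  rw [pow_succ, Module.End.mul_apply, LieAlgebra.ad_apply]

theorem adExp_apply (X v : FreeNilp N d) : adExp X v = ∑ k ∈ Finset.range (N + 1),
    (k ! : ℝ)⁻¹ • (LieAlgebra.ad ℝ (FreeNilp N d) X ^ k) v := by
  simp [adExp, LinearMap.sum_apply]

variable {X X' Z v : FreeNilp N d} {h : ℕ}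

/-- The difference `X - X'` brackets to zero with `v`, and with the still deeper iterated brackets.
-/
theorem IsLayerAdapted.ad_pow_eq (hb : IsLayerAdapted b) (hX : X - X' ∈ deepLayers b h)
    {q : ℕ} (hv : v ∈ deepLayers b q) (hq : N < h + q) (k : ℕ) :
    (LieAlgebra.ad ℝ (FreeNilp N d) X ^ k) v = (LieAlgebra.ad ℝ (FreeNilp N d) X' ^ k) v := by
  induction k generalizing v with
  | zero => rfl
  | succ k ih =>
    have h0 : ⁅X, v⁆ = ⁅X', v⁆ := by
      rw [← sub_eq_zero, ← sub_lie]
      exact hb.lie_eq_zero hX hv hq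
    rw [ad_pow_succ_apply, ad_pow_succ_apply, h0]
    exact ih (deepLayers_anti (by omega) (hb.lie_mem_deepLayers (mem_deepLayers_one (b := b) X') hv))

theorem IsLayerAdapted.adExp_eq (hb : IsLayerAdapted b) (hX : X - X' ∈ deepLayers b h)
    {q : ℕ} (hv : v ∈ deepLayers b q) (hq : N < h + q) : adExp X v = adExp X' v := by
  rw [adExp_apply, adExp_apply]
  exact Finset.sum_congr rfl fun k _ => by rw [hb.ad_pow_eq hX hv hq k]

/-- Here `[Z, v]` lies in the central layer `N`, so `Z` shows up in the linear term of the
exponential only. -/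
theorem IsLayerAdapted.adExp_eq_add (hb : IsLayerAdapted b) (hN : 1 ≤ N)
    (hX : X - X' - Z ∈ deepLayers b (h + 1)) (hZ : Z ∈ deepLayers b h) {q : ℕ}
    (hv : v ∈ deepLayers b q) (hq : h + q = N) : adExp X v = adExp X' v + ⁅Z, v⁆ := by
  have hXX : X - X' ∈ deepLayers b h := by
    have := Submodule.add_mem _ (deepLayers_anti (Nat.le_succ h) hX) hZ
    rwa [sub_add_cancel] at this
  have hlie : ⁅X, v⁆ = ⁅X', v⁆ + ⁅Z, v⁆ := by
    have := hb.lie_eq_zero hX hv (by omega)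
    rw [sub_lie, sub_lie] at this
    rw [← sub_eq_zero, ← this]
    abel
  have hpow : ∀ k, (LieAlgebra.ad ℝ (FreeNilp N d) X ^ (k + 1)) v =
      (LieAlgebra.ad ℝ (FreeNilp N d) X' ^ (k + 1)) v + if k = 0 then ⁅Z, v⁆ else 0 := by
    intro k
    rw [ad_pow_succ_apply, ad_pow_succ_apply, hlie, map_add]
    congr 1
    · exact hb.ad_pow_eq hXX
        (hb.lie_mem_deepLayers (mem_deepLayers_one (b := b) X') hv) (by omega) k
    · cases k with
      | zero => rfl
      | succ k =>
        rw [ad_pow_succ_apply, hb.lie_eq_zero (mem_deepLayers_one (b := b) X)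
          (hb.lie_mem_deepLayers hZ hv) (by omega), map_zero, if_neg (by omega)]
  rw [adExp_apply, adExp_apply, Finset.sum_range_succ', Finset.sum_range_succ' (n := N)]
  simp only [hpow, smul_add, Finset.sum_add_distrib]
  have h1 : ∑ k ∈ Finset.range N, (((k + 1)! : ℕ) : ℝ)⁻¹ • (if k = 0 then ⁅Z, v⁆ else 0) =
      ⁅Z, v⁆ := by
    rw [Finset.sum_eq_single_of_mem 0 (Finset.mem_range.2 hN) fun k _ hk => by
      rw [if_neg hk, smul_zero]]
    simp
  rw [h1]
  abel

end Filtration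

end

/-! ### Hausdorff dimension and the derivative of the orbit map -/

noncomputable section

section Calculus

/-- Project linearly onto the range of the derivative. The composition is a submersion at `x`, so
its image contains an open set there, and the Lipschitz projection cannot raise the Hausdorff
dimension. -/
theorem finrank_range_le_dimH_range {E F : Type*} [NormedAddCommGroup E] [NormedSpace ℝ E]
    [FiniteDimensional ℝ E] [NormedAddCommGroup F] [NormedSpace ℝ F] [FiniteDimensional ℝ F]
    {f : E → F} {f' : E →L[ℝ] F} {x : E} (hf : HasStrictFDerivAt f f' x) :
    (finrank ℝ (LinearMap.range f'.toLinearMap) : ℝ≥0∞) ≤ dimH (Set.range f) := by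
  set R := LinearMap.range f'.toLinearMap
  obtain ⟨p, hp⟩ := R.subtype.exists_leftInverse_of_injective R.ker_subtype
  let P : F →L[ℝ] R := LinearMap.toContinuousLinearMap p
  have hsurj : LinearMap.range (P.comp f').toLinearMap = ⊤ := by
    refine LinearMap.range_eq_top.2 fun r => ?_
    obtain ⟨e, he⟩ := r.2
    exact ⟨e, (congrArg p he).trans (LinearMap.congr_fun hp r)⟩
  have hg : HasStrictFDerivAt (fun y => P (f y)) (P.comp f') x :=
    P.hasStrictFDerivAt.comp x hf
  have hnhds : Set.range (fun y => P (f y)) ∈ nhds (P (f x)) := by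
    rw [← hg.map_nhds_eq_of_surj hsurj]
    exact Filter.mem_map.2 (Filter.univ_mem' fun y => ⟨y, rfl⟩)
  calc (finrank ℝ R : ℝ≥0∞) = dimH (Set.range fun y => P (f y)) :=
        (Real.dimH_of_mem_nhds hnhds).symm
    _ = dimH (P '' Set.range f) := by rw [← Set.range_comp]; rfl
    _ ≤ dimH (Set.range f) := P.lipschitz.dimH_image_le _

end Calculus

section AdExp

variable {N d : ℕ} {κ : Type} [Fintype κ]

theorem lie_sum_smul_apply (ℓ : Dual ℝ (FreeNilp N d)) (w : κ → FreeNilp N d)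
    (v : FreeNilp N d) (k : ℕ) (c : κ → ℝ) :
    ℓ ((LieAlgebra.ad ℝ (FreeNilp N d) (∑ a, c a • w a) ^ (k + 1)) v) =
      ∑ a, c a * ℓ ((LieAlgebra.ad ℝ (FreeNilp N d) (∑ a, c a • w a) ^ k) ⁅w a, v⁆) := by
  rw [ad_pow_succ_apply, sum_lie, map_sum, map_sum]
  exact Finset.sum_congr rfl fun a _ => by rw [smul_lie, map_smul, map_smul, smul_eq_mul]

theorem contDiff_ad_pow (ℓ : Dual ℝ (FreeNilp N d)) (w : κ → FreeNilp N d) (v : FreeNilp N d)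
    (k : ℕ) : ContDiff ℝ 1 fun c : κ → ℝ =>
      ℓ ((LieAlgebra.ad ℝ (FreeNilp N d) (∑ a, c a • w a) ^ k) v) := by
  induction k generalizing v with
  | zero => simpa using contDiff_const
  | succ k ih =>
    simp only [lie_sum_smul_apply]
    exact ContDiff.sum fun a _ => (contDiff_apply ℝ ℝ a).mul (ih _)

theorem contDiff_adExp (ℓ : Dual ℝ (FreeNilp N d)) (w : κ → FreeNilp N d) (v : FreeNilp N d) :
    ContDiff ℝ 1 fun c : κ → ℝ => ℓ (adExp (∑ a, c a • w a) v) := by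
  have h : ∀ c : κ → ℝ, ℓ (adExp (∑ a, c a • w a) v) = ∑ k ∈ Finset.range (N + 1),
      ((k ! : ℕ) : ℝ)⁻¹ *
        ℓ ((LieAlgebra.ad ℝ (FreeNilp N d) (∑ a, c a • w a) ^ k) v) := by
    intro c
    rw [adExp_apply, map_sum]
    exact Finset.sum_congr rfl fun k _ => by rw [map_smul, smul_eq_mul]
  simp only [h]
  exact ContDiff.sum fun k _ => contDiff_const.mul (contDiff_ad_pow ℓ w v k)

/-- Product rule at `0`: the factor `c a` vanishes there, and the other factor has the value `0`
unless `k = 0`. -/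
theorem hasStrictFDerivAt_ad_pow (ℓ : Dual ℝ (FreeNilp N d)) (w : κ → FreeNilp N d)
    (v : FreeNilp N d) (k : ℕ) : HasStrictFDerivAt (fun c : κ → ℝ =>
      ℓ ((LieAlgebra.ad ℝ (FreeNilp N d) (∑ a, c a • w a) ^ (k + 1)) v))
      (∑ a, (if k = 0 then ℓ ⁅w a, v⁆ else 0) •
        (ContinuousLinearMap.proj a : (κ → ℝ) →L[ℝ] ℝ)) 0 := by
  simp only [lie_sum_smul_apply]
  refine HasStrictFDerivAt.fun_sum fun a _ => ?_
  have h1 : HasStrictFDerivAt (fun c : κ → ℝ => c a)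
      (ContinuousLinearMap.proj a : (κ → ℝ) →L[ℝ] ℝ) 0 :=
    (ContinuousLinearMap.proj a : (κ → ℝ) →L[ℝ] ℝ).hasStrictFDerivAt
  have h2 := (contDiff_ad_pow ℓ w ⁅w a, v⁆ k).contDiffAt.hasStrictFDerivAt (x := 0) one_ne_zero
  refine (h1.mul h2).congr_fderiv ?_
  have h0 : ℓ ((LieAlgebra.ad ℝ (FreeNilp N d) (∑ a, (0 : κ → ℝ) a • w a) ^ k) ⁅w a, v⁆) =
      if k = 0 then ℓ ⁅w a, v⁆ else 0 := by
    cases k with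
    | zero => simp
    | succ k => simp
  rw [h0, Pi.zero_apply, zero_smul, zero_add]

theorem hasStrictFDerivAt_adExp (hN : 1 ≤ N) (ℓ : Dual ℝ (FreeNilp N d))
    (w : κ → FreeNilp N d) (v : FreeNilp N d) :
    HasStrictFDerivAt (fun c : κ → ℝ => ℓ (adExp (∑ a, c a • w a) v))
      (∑ a, ℓ ⁅w a, v⁆ • (ContinuousLinearMap.proj a : (κ → ℝ) →L[ℝ] ℝ)) 0 := by
  have h : ∀ c : κ → ℝ, ℓ (adExp (∑ a, c a • w a) v) = ∑ k ∈ Finset.range N,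
      (((k + 1)! : ℕ) : ℝ)⁻¹ *
        ℓ ((LieAlgebra.ad ℝ (FreeNilp N d) (∑ a, c a • w a) ^ (k + 1)) v) + ℓ v := by
    intro c
    rw [adExp_apply, Finset.sum_range_succ', map_add, map_sum]
    simp
  simp only [h]
  have h1 := (HasStrictFDerivAt.fun_sum (u := Finset.range N) fun k _ =>
    (hasStrictFDerivAt_ad_pow ℓ w v k).const_mul ((((k + 1)! : ℕ) : ℝ)⁻¹)).add_const (ℓ v)
  refine h1.congr_fderiv ?_
  rw [Finset.sum_eq_single_of_mem 0 (Finset.mem_range.2 hN)]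
  · simp
  · intro k _ hk
    simp [hk]

end AdExp

/-! ### Lower and upper bounds for projected orbits -/

section Orbit

variable {N d : ℕ} {m : ℕ → ℕ} {b : Basis (LayerIndex N m) ℝ (FreeNilp N d)}

theorem projOrbit_eq_range (b : Basis (LayerIndex N m) ℝ (FreeNilp N d))
    (ℓ : Dual ℝ (FreeNilp N d)) (j : LayerIndex N m) :
    projOrbit b ℓ j = Set.range fun (X : FreeNilp N d) (i : {i // i ≤ j}) => ℓ (adExp X (b i)) := by
  ext y
  constructor
  · rintro ⟨_, ⟨X, rfl⟩, rfl⟩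
    exact ⟨-X, rfl⟩
  · rintro ⟨X, rfl⟩
    refine ⟨_, ⟨-X, rfl⟩, ?_⟩
    simp

/-- The coordinates of `ad^* X ℓ` in `S`, up to sign. -/
def infOrbit (b : Basis (LayerIndex N m) ℝ (FreeNilp N d)) (ℓ : Dual ℝ (FreeNilp N d))
    (S : Set (LayerIndex N m)) : FreeNilp N d →ₗ[ℝ] (S → ℝ) :=
  LinearMap.pi fun i => ℓ ∘ₗ
    { toFun := fun X => ⁅X, b i⁆
      map_add' := fun _ _ => add_lie _ _ _
      map_smul' := fun _ _ => smul_lie _ _ _ }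

theorem infOrbit_apply (ℓ : Dual ℝ (FreeNilp N d)) (S : Set (LayerIndex N m))
    (X : FreeNilp N d) (i : S) : infOrbit b ℓ S X i = ℓ ⁅X, b i⁆ := rfl

/-- `infOrbit` is the derivative at `0` of the map that parametrizes the projected orbit. -/
theorem finrank_range_infOrbit_le (hN : 1 ≤ N) (ℓ : Dual ℝ (FreeNilp N d))
    (j : LayerIndex N m) :
    (finrank ℝ (LinearMap.range (infOrbit b ℓ (Set.Iic j))) : ℝ≥0∞) ≤ projOrbitDim b ℓ j := by
  have hr : projOrbit b ℓ j = Set.range fun (c : LayerIndex N m → ℝ) (i : {i // i ≤ j}) =>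
      ℓ (adExp (∑ a, c a • b a) (b i)) := by
    rw [projOrbit_eq_range]
    ext y
    constructor
    · rintro ⟨X, rfl⟩
      exact ⟨b.repr X, by simp only [b.sum_repr]⟩
    · rintro ⟨c, rfl⟩
      exact ⟨_, rfl⟩
  let D : (LayerIndex N m → ℝ) →L[ℝ] ({i // i ≤ j} → ℝ) :=
    ContinuousLinearMap.pi fun i : {i // i ≤ j} =>
      ∑ a, ℓ ⁅b a, b i⁆ • (ContinuousLinearMap.proj a : (LayerIndex N m → ℝ) →L[ℝ] ℝ)
  have hd : HasStrictFDerivAt (fun (c : LayerIndex N m → ℝ) (i : {i // i ≤ j}) =>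
      ℓ (adExp (∑ a, c a • b a) (b i))) D 0 :=
    hasStrictFDerivAt_pi.2 fun i => hasStrictFDerivAt_adExp hN ℓ b (b i)
  rw [projOrbitDim, hr]
  refine le_trans (le_of_eq ?_) (finrank_range_le_dimH_range hd)
  suffices h : LinearMap.range (infOrbit b ℓ (Set.Iic j)) = LinearMap.range D.toLinearMap by
    exact congrArg (fun R : Submodule ℝ (Set.Iic j → ℝ) => (finrank ℝ R : ℝ≥0∞)) h
  have hD : ∀ c : LayerIndex N m → ℝ, infOrbit b ℓ (Set.Iic j) (∑ a, c a • b a) = D c := by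
    refine fun c => funext fun i => ?_
    have h1 : D c i = ∑ a, ℓ ⁅b a, b i⁆ * c a := by simp [D]
    rw [infOrbit_apply, h1]
    simp [sum_lie, mul_comm]
  ext y
  constructor
  · rintro ⟨X, rfl⟩
    refine ⟨b.repr X, ?_⟩
    conv_rhs => rw [← b.sum_repr X]
    exact (hD _).symm
  · rintro ⟨c, rfl⟩
    exact ⟨∑ a, c a • b a, hD c⟩

/-- One step of the block triangular rank estimate: restricting to the layers beyond `N - k` kills
the image of layer `k`, and on layer `N - k` this image has at least the rank of the pairing. -/
theorem IsLayerAdapted.add_le_finrank_range_infOrbit (hb : IsLayerAdapted b)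
    (ℓ : Dual ℝ (FreeNilp N d)) {k n : ℕ} (hk : k ∈ Finset.Icc 1 (N - 1))
    (S : Set (LayerIndex N m)) (hS : ∀ i, N - k < i.layer → i ∈ S)
    (hn : ∀ i, i.layer = N - k → i.pos ≤ n → i ∈ S) :
    finrank ℝ (LinearMap.range (infOrbit b ℓ {i | N - k < i.layer})) + (pairing b ℓ k n).rank ≤
      finrank ℝ (LinearMap.range (infOrbit b ℓ S)) := by
  obtain ⟨hk1, hkN⟩ := Finset.mem_Icc.1 hk
  have hkI : k ∈ Finset.Icc 1 N := Finset.mem_Icc.2 ⟨hk1, by omega⟩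
  have hNkI : N - k ∈ Finset.Icc 1 N := Finset.mem_Icc.2 ⟨by omega, by omega⟩
  set T : Set (LayerIndex N m) := {i | N - k < i.layer}
  let π : (S → ℝ) →ₗ[ℝ] (T → ℝ) := LinearMap.funLeft ℝ ℝ fun i : T => (⟨i, hS i i.2⟩ : S)
  have hπ : π ∘ₗ infOrbit b ℓ S = infOrbit b ℓ T := rfl
  set R := LinearMap.range (infOrbit b ℓ S)
  let K : Submodule ℝ (S → ℝ) := (layer N d k).map (infOrbit b ℓ S)
  have hKR : K ≤ R := LinearMap.map_le_range
  have hKπ : K ≤ LinearMap.ker π := by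
    rintro _ ⟨X, hX, rfl⟩
    refine funext fun i => ?_
    change ℓ ⁅X, b i⁆ = 0
    have hi : N - k < (i : LayerIndex N m).layer := i.2
    rw [hb.lie_eq_zero (hb.layer_le_deepLayers hk1 hX) (mem_deepLayers le_rfl) (by omega), map_zero]
  have hrn := LinearMap.finrank_range_add_finrank_ker (π.domRestrict R)
  have hrange : LinearMap.range (π.domRestrict R) = LinearMap.range (infOrbit b ℓ T) := by
    rw [LinearMap.range_domRestrict, ← hπ, LinearMap.range_comp]
  have hker : finrank ℝ K ≤ finrank ℝ (LinearMap.ker (π.domRestrict R)) := by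
    refine LinearMap.finrank_le_finrank_of_injective
      (f := (Submodule.inclusion hKR).codRestrict _ fun x => ?_) ?_
    · exact hKπ x.2
    · intro x y hxy
      exact Subtype.ext (congrArg (fun z => ((z : R) : S → ℝ)) (congrArg Subtype.val hxy))
  have hrank : (pairing b ℓ k n).rank ≤ finrank ℝ K := by
    classical
    -- `G` reads off the first `n` coordinates in layer `N - k`, with zeros beyond the end of the
    -- layer.
    let G : (S → ℝ) →ₗ[ℝ] (Fin n → ℝ) := LinearMap.pi fun q =>
      if h : (q : ℕ) < m (N - k) then LinearMap.proj
        (⟨LayerIndex.mk (N - k) hNkI ⟨q, h⟩, hn _ rfl q.2⟩ : S) else 0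
    rw [Matrix.rank_eq_finrank_span_row]
    refine le_trans (Submodule.finrank_mono ?_) (Submodule.finrank_map_le G K)
    rw [Submodule.span_le]
    rintro _ ⟨p, rfl⟩
    refine ⟨infOrbit b ℓ S (layerVec b k p), ⟨_, ?_, rfl⟩, funext fun q => ?_⟩
    · rw [layerVec_eq hkI p.2]
      exact hb.mem_layer (LayerIndex.mk k hkI ⟨p, p.2⟩)
    · change G _ q = ℓ ⁅layerVec b k p, layerVec b (N - k) q⁆
      by_cases h : (q : ℕ) < m (N - k)
      · simp only [G, LinearMap.pi_apply, dif_pos h, layerVec_eq hNkI h]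
        rfl
      · simp only [G, LinearMap.pi_apply, dif_neg h, layerVec_eq_zero (not_lt.1 h)]
        simp
  rw [hrange] at hrn
  omega

theorem IsLayerAdapted.sum_rank_le (hb : IsLayerAdapted b) (ℓ : Dual ℝ (FreeNilp N d)) {k : ℕ}
    (hk : k ≤ N) : ∑ s ∈ Finset.Icc 1 (k - 1), (pairing b ℓ s (m (N - s))).rank ≤
      finrank ℝ (LinearMap.range (infOrbit b ℓ {i | N - k < i.layer})) := by
  induction k with
  | zero => simp
  | succ k ih =>
    rw [Nat.add_sub_cancel]
    rcases Nat.eq_zero_or_pos k with rfl | hk0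
    · simp
    · have h := hb.add_le_finrank_range_infOrbit ℓ (k := k) (n := m (N - k))
        (Finset.mem_Icc.2 ⟨hk0, by omega⟩) {i | N - (k + 1) < i.layer}
        (fun i hi => by change N - (k + 1) < i.layer; omega)
        (fun i hi _ => by change N - (k + 1) < i.layer; omega)
      obtain ⟨k, rfl⟩ : ∃ l, k = l + 1 := ⟨k - 1, by omega⟩
      rw [Finset.sum_Icc_succ_top (by omega)]
      have := ih (by omega)
      rw [Nat.add_sub_cancel] at this
      omega

/-- The lower bound for the dimension of the orbit by the ranks of the pairings. -/
theorem IsLayerAdapted.le_projOrbitDim (hb : IsLayerAdapted b) (ℓ : Dual ℝ (FreeNilp N d))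
    {k : ℕ} (hk : k ∈ Finset.Icc 1 (N - 1)) (j : LayerIndex N m) (hj : j.layer = N - k) :
    ((∑ s ∈ Finset.Icc 1 (k - 1), (pairing b ℓ s (m (N - s))).rank +
      (pairing b ℓ k j.pos).rank : ℕ) : ℝ≥0∞) ≤ projOrbitDim b ℓ j := by
  have hk' := Finset.mem_Icc.1 hk
  refine le_trans (Nat.cast_le.2 ?_) (finrank_range_infOrbit_le (by omega) ℓ j)
  have h1 := hb.sum_rank_le ℓ (k := k) (by omega)
  have h2 := hb.add_le_finrank_range_infOrbit ℓ hk (n := j.pos) (Set.Iic j)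
    (fun i hi => LayerIndex.le_iff.2 (Or.inl (by omega)))
    (fun i hi hp => LayerIndex.le_iff.2 (Or.inr ⟨by omega, hp⟩))
  omega

/-- The upper bound for the dimension of the orbit: the components in the layers below the `h`-th
one and the pairing of the `h`-th layer with its complementary layer are parameters, and the
coordinates in the layers below the complementary one are free. -/
theorem IsLayerAdapted.projOrbitDim_le (hb : IsLayerAdapted b) (ℓ : Dual ℝ (FreeNilp N d))
    {h n : ℕ} (hh : h ∈ Finset.Icc 1 (N - 1)) (j : LayerIndex N m)
    (hn : ∀ i, i ≤ j → i.layer = N - h → i.pos ≤ n) :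
    projOrbitDim b ℓ j ≤ ((∑ s ∈ Finset.Icc 1 (h - 1), m s + (pairing b ℓ h n).rank +
      (Finset.univ.filter fun i : LayerIndex N m => i ≤ j ∧ i.layer < N - h).card : ℕ) : ℝ≥0∞) := by
  classical
  obtain ⟨hh1, hhN⟩ := Finset.mem_Icc.1 hh
  have hhI : h ∈ Finset.Icc 1 N := Finset.mem_Icc.2 ⟨hh1, by omega⟩
  let A := {a : LayerIndex N m // a.layer < h}
  let C := {i : LayerIndex N m // i ≤ j ∧ i.layer < N - h}
  let R : Submodule ℝ (Fin n → ℝ) := LinearMap.range (pairing b ℓ h n).transpose.mulVecLin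
  -- Coordinates below layer `N - h` are free, those in layer `N - h` are a function of the
  -- components below `h` plus a vector in `R`, and the deeper ones depend on these components
  -- alone. The shift by one is due to `pos` counting from `1`.
  let Φ : (A → ℝ) × R × (C → ℝ) → {i // i ≤ j} → ℝ := fun p i =>
    if hi : (i : LayerIndex N m).layer < N - h then p.2.2 ⟨i, i.2, hi⟩
    else ℓ (adExp (∑ a, p.1 a • b a) (b i)) +
      if hi : (i : LayerIndex N m).layer = N - h then
        (p.2.1 : Fin n → ℝ) ⟨(i : LayerIndex N m).pos - 1, by
          have := hn i i.2 hi
          have := (i : LayerIndex N m).one_le_pos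
          omega⟩
      else 0
  have hΦ : ContDiff ℝ 1 Φ := by
    refine contDiff_pi.2 fun i => ?_
    by_cases hi : (i : LayerIndex N m).layer < N - h
    · simp only [Φ, dif_pos hi]
      exact (contDiff_apply ℝ ℝ _).comp (contDiff_snd.comp contDiff_snd)
    · simp only [Φ, dif_neg hi]
      refine ContDiff.add ((contDiff_adExp ℓ _ _).comp contDiff_fst) ?_
      by_cases hi' : (i : LayerIndex N m).layer = N - h
      · simp only [dif_pos hi']
        exact (contDiff_apply ℝ ℝ _).comp
          (R.subtypeL.contDiff.comp (contDiff_fst.comp contDiff_snd))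
      · simp only [dif_neg hi']
        exact contDiff_const
  have hsub : projOrbit b ℓ j ⊆ Set.range Φ := by
    rw [projOrbit_eq_range]
    rintro _ ⟨X, rfl⟩
    let z : Fin (m h) → ℝ := fun p => b.repr X (LayerIndex.mk h hhI p)
    refine ⟨(fun a => b.repr X a, ⟨_, z, rfl⟩, fun i => ℓ (adExp X (b i))), funext fun i => ?_⟩
    by_cases hi : (i : LayerIndex N m).layer < N - h
    · simp only [Φ, dif_pos hi]
    · simp only [Φ, dif_neg hi]
      -- `X` is the sum of `X'` in the layers below `h`, of `Z` in layer `h`, and of deeper terms,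
      -- which the remaining coordinates do not see.
      set X' : FreeNilp N d := ∑ a : A, b.repr X a • b a
      set Z : FreeNilp N d := ∑ p : Fin (m h), z p • b (LayerIndex.mk h hhI p)
      have hX' : X' = ∑ a with a.layer < h, b.repr X a • b a :=
        (Finset.sum_subtype _ (by simp) fun a => b.repr X a • b a).symm
      have hZ' : Z = ∑ a with a.layer = h, b.repr X a • b a := by
        refine Finset.sum_bij (fun p _ => LayerIndex.mk h hhI p) (by simp)
          (fun p _ q _ hpq => LayerIndex.mk_injective h hhI hpq) (fun a ha => ?_) (fun _ _ => rfl)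
        obtain ⟨p, rfl⟩ := LayerIndex.exists_eq_mk_of_layer_eq (Finset.mem_filter.1 ha).2 hhI
        exact ⟨p, Finset.mem_univ _, rfl⟩
      have hsplit : X - X' - Z = ∑ a with h < a.layer, b.repr X a • b a := by
        rw [sub_sub, sub_eq_iff_eq_add, hX', hZ', Finset.sum_filter, Finset.sum_filter,
          Finset.sum_filter, ← Finset.sum_add_distrib, ← Finset.sum_add_distrib]
        conv_lhs => rw [← b.sum_repr X]
        refine Finset.sum_congr rfl fun a _ => ?_
        rcases lt_trichotomy a.layer h with h' | h' | h'
        · simp [h', h'.ne, h'.not_gt]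
        · simp [h']
        · simp [h', h'.ne', h'.not_gt]
      have hdeep : X - X' - Z ∈ deepLayers b (h + 1) := by
        rw [hsplit]
        exact Submodule.sum_mem _ fun a ha => Submodule.smul_mem _ _
          (mem_deepLayers (Finset.mem_filter.1 ha).2)
      have hZ : Z ∈ deepLayers b h := Submodule.sum_mem _ fun p _ =>
        Submodule.smul_mem _ _ (mem_deepLayers le_rfl)
      by_cases hi' : (i : LayerIndex N m).layer = N - h
      · simp only [dif_pos hi']
        rw [hb.adExp_eq_add (by omega) hdeep hZ (mem_deepLayers (le_of_eq hi'.symm)) (by omega),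
          map_add]
        congr 1
        simp only [Matrix.mulVecLin_apply, Matrix.mulVec, dotProduct, Matrix.transpose_apply,
          pairing, Matrix.of_apply, Z, sum_lie, smul_lie, map_sum, map_smul, smul_eq_mul]
        refine Finset.sum_congr rfl fun p _ => ?_
        rw [layerVec_eq hhI p.2, basis_eq_layerVec (i : LayerIndex N m), hi', mul_comm]
      · simp only [dif_neg hi', add_zero]
        have hX : X - X' ∈ deepLayers b h := by
          have := Submodule.add_mem _ (deepLayers_anti (Nat.le_succ h) hdeep) hZ
          rwa [sub_add_cancel] at this
        rw [hb.adExp_eq hX (mem_deepLayers le_rfl) (by omega)]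
  refine (dimH_mono hsub).trans (hΦ.dimH_range_le.trans (Nat.cast_le.2 (le_of_eq ?_)))
  have hR : finrank ℝ R = (pairing b ℓ h n).rank := by
    rw [← Matrix.rank_transpose]
    rfl
  rw [finrank_prod, finrank_prod, finrank_fintype_fun_eq_card, finrank_fintype_fun_eq_card, hR,
    Fintype.card_subtype, Fintype.card_subtype, ← add_assoc,
    ← LayerIndex.card_layer_mem (N := N) (m := m) (s := Finset.Icc 1 (h - 1))
      (Finset.Icc_subset_Icc le_rfl (by omega))]
  congr 3
  ext a
  have := a.one_le_layer
  simp only [Finset.mem_filter, Finset.mem_univ, true_and, Finset.mem_Icc]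
  omega

end Orbit

end

/-! ### Generic functionals and the ranks of the pairings -/

noncomputable section

section Generic

/-- The determinants are nonzero polynomials in the coordinates of `ℓ`; so is their product, which
is then nonzero at some real point. -/
theorem Module.Basis.exists_dual_forall_det_ne_zero {ι V κ : Type*} [Fintype ι] [AddCommGroup V]
    [Module ℝ V] (b : Basis ι ℝ V) (s : Finset κ) (p : κ → ℕ)
    (A : ∀ k, Fin (p k) → Fin (p k) → V)
    (h : ∀ k ∈ s, ∃ ℓ : Dual ℝ V, (Matrix.of fun i j => ℓ (A k i j)).det ≠ 0) :
    ∃ ℓ : Dual ℝ V, ∀ k ∈ s, (Matrix.of fun i j => ℓ (A k i j)).det ≠ 0 := by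
  let P : κ → MvPolynomial ι ℝ := fun k => (Matrix.of fun i j =>
    ∑ a, MvPolynomial.C (b.repr (A k i j) a) * MvPolynomial.X a).det
  have hP : ∀ (k : κ) (ℓ : Dual ℝ V), MvPolynomial.eval (fun a => ℓ (b a)) (P k) =
      (Matrix.of fun i j => ℓ (A k i j)).det := by
    intro k ℓ
    rw [RingHom.map_det]
    congr 1
    ext i j
    conv_rhs => rw [Matrix.of_apply, ← b.sum_repr (A k i j), map_sum]
    simp only [map_smul, smul_eq_mul]
    simp
  have hprod : ∏ k ∈ s, P k ≠ 0 := Finset.prod_ne_zero_iff.2 fun k hk h0 => by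
    obtain ⟨ℓ, hℓ⟩ := h k hk
    exact hℓ (by rw [← hP, h0, map_zero])
  obtain ⟨c, hc⟩ : ∃ c, MvPolynomial.eval c (∏ k ∈ s, P k) ≠ 0 := by
    by_contra! hc
    exact hprod (MvPolynomial.funext fun x => by rw [hc, map_zero])
  rw [map_prod, Finset.prod_ne_zero_iff] at hc
  refine ⟨b.constr ℝ c, fun k hk => ?_⟩
  rw [← hP]
  simpa only [Basis.constr_basis] using hc k hk

end Generic

section Ranks

variable {N d : ℕ} {m : ℕ → ℕ} {b : Basis (LayerIndex N m) ℝ (FreeNilp N d)}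
  {ℓ : Dual ℝ (FreeNilp N d)} {k n p : ℕ}

/-- The columns of the matrices `B_ℓ^k(n)`. -/
def pairingCol (b : Basis (LayerIndex N m) ℝ (FreeNilp N d)) (ℓ : Dual ℝ (FreeNilp N d))
    (k j : ℕ) : Fin (m k) → ℝ :=
  fun i => ℓ ⁅layerVec b k i, layerVec b (N - k) j⁆

theorem rank_pairing_eq_finrank_span : (pairing b ℓ k n).rank =
    finrank ℝ (Submodule.span ℝ (Set.range fun j : Fin n => pairingCol b ℓ k j)) :=
  Matrix.rank_eq_finrank_span_cols _

/-- Independence of the first columns controls the rank for every `n` at once. -/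
theorem min_le_rank_pairing (h : LinearIndependent ℝ fun j : Fin p => pairingCol b ℓ k j) (n : ℕ) :
    min p n ≤ (pairing b ℓ k n).rank := by
  have h' := h.comp (Fin.castLE (min_le_left p n)) (Fin.castLE_injective _)
  have hc := finrank_span_eq_card h'
  rw [Fintype.card_fin] at hc
  rw [rank_pairing_eq_finrank_span, ← hc]
  refine Submodule.finrank_mono (Submodule.span_mono ?_)
  rintro _ ⟨j, rfl⟩
  exact ⟨⟨j, j.2.trans_le (min_le_right p n)⟩, rfl⟩

theorem linearIndependent_pairingCol (h : n ≤ (pairing b ℓ k n).rank) :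
    LinearIndependent ℝ fun j : Fin n => pairingCol b ℓ k j := by
  rw [linearIndependent_iff_card_le_finrank_span, Fintype.card_fin]
  exact h.trans_eq rank_pairing_eq_finrank_span

theorem rank_pairing_le_rank (b : Basis (LayerIndex N m) ℝ (FreeNilp N d))
    (ℓ : Dual ℝ (FreeNilp N d)) (k n : ℕ) :
    (pairing b ℓ k n).rank ≤ (pairing b ℓ k (m (N - k))).rank := by
  rw [rank_pairing_eq_finrank_span, rank_pairing_eq_finrank_span]
  refine Submodule.finrank_mono (Submodule.span_le.2 ?_)
  rintro _ ⟨j, rfl⟩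
  rcases lt_or_ge (j : ℕ) (m (N - k)) with h | h
  · exact Submodule.subset_span ⟨⟨j, h⟩, rfl⟩
  · have : pairingCol b ℓ k j = 0 := funext fun i => by
      simp [pairingCol, layerVec_eq_zero h]
    change pairingCol b ℓ k j ∈ _
    rw [this]
    exact Submodule.zero_mem _

theorem sqPairing_transpose (hk : 2 * k = N) :
    (sqPairing b ℓ k).transpose = - sqPairing b ℓ k := by
  ext i j
  change ℓ ⁅layerVec b k j, layerVec b (N - k) i⁆ = -ℓ ⁅layerVec b k i, layerVec b (N - k) j⁆
  rw [← map_neg, lie_skew, show N - k = k by omega]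

/-- The middle matrix is skew, so its rows are the negatives of its columns. -/
theorem firstRowsIndependent_iff (hk : 2 * k = N) : FirstRowsIndependent b ℓ k ↔
    LinearIndependent ℝ fun j : Fin (m k - 1) => pairingCol b ℓ k j := by
  rw [← LinearMap.linearIndependent_iff (LinearEquiv.neg ℝ).toLinearMap (LinearEquiv.ker _)]
  have h : (fun i : Fin (m k - 1) => sqPairing b ℓ k (Fin.castLE (Nat.sub_le (m k) 1) i)) =
      (LinearEquiv.neg ℝ).toLinearMap ∘ fun j : Fin (m k - 1) => pairingCol b ℓ k j := by
    refine funext fun j => funext fun i => ?_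
    change ℓ ⁅layerVec b k j, layerVec b (N - k) i⁆ = -ℓ ⁅layerVec b k i, layerVec b (N - k) j⁆
    rw [← map_neg, lie_skew, show N - k = k by omega]
  rw [FirstRowsIndependent, h]

theorem Matrix.rank_le_of_transpose_eq_neg {n : ℕ} {A : Matrix (Fin n) (Fin n) ℝ}
    (hA : A.transpose = -A) (hn : Odd n) : A.rank ≤ n - 1 := by
  have hdet : A.det = 0 := by
    have h := A.det_transpose
    rw [hA, Matrix.det_neg, Fintype.card_fin, hn.neg_one_pow] at h
    linarith
  have hr : A.rank ≠ n := fun h => by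
    have hu : IsUnit A := by
      rw [← Matrix.linearIndependent_cols_iff_isUnit, linearIndependent_iff_card_le_finrank_span,
        Fintype.card_fin]
      exact h.ge.trans_eq A.rank_eq_finrank_span_cols
    exact ((Matrix.isUnit_iff_isUnit_det A).1 hu).ne_zero hdet
  have := A.rank_le_width
  omega

/-- The maximal rank of `B_ℓ^k(n)` over all `ℓ` and `n`. -/
def maxRank (N : ℕ) (m : ℕ → ℕ) (k : ℕ) : ℕ :=
  if 2 * k = N then (if Even (m k) then m k else m k - 1) else min (m k) (m (N - k))

theorem maxRank_le_left : maxRank N m k ≤ m k := by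
  unfold maxRank
  split_ifs <;> omega

theorem maxRank_le_right (hk : k ≤ N) : maxRank N m k ≤ m (N - k) := by
  unfold maxRank
  split_ifs with h
  · rw [show N - k = k by omega]
  · rw [show N - k = k by omega]
    omega
  · omega

theorem maxRank_of_odd (h : 2 * k = N ∧ Odd (m k)) : maxRank N m k = m k - 1 := by
  rw [maxRank, if_pos h.1, if_neg (Nat.not_even_iff_odd.2 h.2)]

theorem rank_pairing_le (b : Basis (LayerIndex N m) ℝ (FreeNilp N d))
    (ℓ : Dual ℝ (FreeNilp N d)) (k n : ℕ) :
    (pairing b ℓ k n).rank ≤ min (maxRank N m k) n := by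
  have h1 := (pairing b ℓ k n).rank_le_height
  have h2 := (pairing b ℓ k n).rank_le_width
  have h3 := rank_pairing_le_rank b ℓ k n
  have h4 := (pairing b ℓ k (m (N - k))).rank_le_width
  refine le_min ?_ h2
  unfold maxRank
  split_ifs with h h'
  · exact h1
  · rw [show N - k = k by omega] at h3
    exact h3.trans (Matrix.rank_le_of_transpose_eq_neg (sqPairing_transpose h)
      (Nat.not_even_iff_odd.1 h'))
  · omega

/-- The dimensions of the layers grow. -/
theorem IsLayerAdapted.dim_le (hb : IsLayerAdapted b) (hd : 2 ≤ d ∨ N ≤ 2)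
    (hex : ¬ (N = 3 ∧ d = 2)) (hk : 1 ≤ k) (hkN : 2 * k < N) : m k ≤ m (N - k) := by
  rw [← hb.finrank_layer_eq (Finset.mem_Icc.2 ⟨hk, by omega⟩),
    ← hb.finrank_layer_eq (k := N - k) (Finset.mem_Icc.2 ⟨by omega, by omega⟩)]
  exact finrank_layer_le (by omega) (by omega) (by omega) (by omega)

theorem IsLayerAdapted.maxRank_eq_of_lt (hb : IsLayerAdapted b) (hd : 2 ≤ d ∨ N ≤ 2)
    (hex : ¬ (N = 3 ∧ d = 2)) (hk : 1 ≤ k) (hkN : 2 * k < N) : maxRank N m k = m k := by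
  rw [maxRank, if_neg (by omega), min_eq_left (hb.dim_le hd hex hk hkN)]

theorem IsLayerAdapted.maxRank_eq_of_gt (hb : IsLayerAdapted b) (hd : 2 ≤ d ∨ N ≤ 2)
    (hex : ¬ (N = 3 ∧ d = 2)) (hk : k < N) (hkN : N < 2 * k) : maxRank N m k = m (N - k) := by
  have h := hb.dim_le hd hex (k := N - k) (by omega) (by omega)
  rw [Nat.sub_sub_self hk.le] at h
  rw [maxRank, if_neg (by omega), min_eq_right h]

theorem IsLayerAdapted.maxRank_eq_of_not_odd (hb : IsLayerAdapted b) (hd : 2 ≤ d ∨ N ≤ 2)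
    (hex : ¬ (N = 3 ∧ d = 2)) (hk : k ∈ Finset.Icc 1 (N / 2)) (h : ¬ (2 * k = N ∧ Odd (m k))) :
    maxRank N m k = m k := by
  obtain ⟨hk1, hkN⟩ := Finset.mem_Icc.1 hk
  rcases Nat.lt_or_ge (2 * k) N with h' | h'
  · exact hb.maxRank_eq_of_lt hd hex hk1 h'
  · have h2 : 2 * k = N := by omega
    rw [maxRank, if_pos h2, if_pos (Nat.not_odd_iff_even.1 fun ho => h ⟨h2, ho⟩)]

/-- The functionals for which the matrices `B_ℓ^k`, `k ≤ N / 2`, are as nondegenerate as possible. -/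
def IsNondegenerate (b : Basis (LayerIndex N m) ℝ (FreeNilp N d)) (ℓ : Dual ℝ (FreeNilp N d)) : Prop :=
  ∀ k ∈ Finset.Icc 1 (N / 2),
    (¬ (2 * k = N ∧ Odd (m k)) → IsUnit (sqPairing b ℓ k)) ∧
    (2 * k = N ∧ Odd (m k) → (sqPairing b ℓ k).rank = m k - 1 ∧ FirstRowsIndependent b ℓ k)

/-- For `k > N/2` the columns, cut to their first `m (N - k)` entries, are the negatives of the rows
of the invertible matrix `sqPairing b ℓ (N - k)`. -/
theorem IsNondegenerate.linearIndependent_pairingCol (h : IsNondegenerate b ℓ) (hb : IsLayerAdapted b)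
    (hd : 2 ≤ d ∨ N ≤ 2) (hex : ¬ (N = 3 ∧ d = 2)) (hk : k ∈ Finset.Icc 1 (N - 1)) :
    LinearIndependent ℝ fun j : Fin (maxRank N m k) => pairingCol b ℓ k j := by
  obtain ⟨hk1, hkN⟩ := Finset.mem_Icc.1 hk
  rcases Nat.lt_or_ge N (2 * k) with h' | h'
  · have hk' : N - k ∈ Finset.Icc 1 (N / 2) := Finset.mem_Icc.2 ⟨by omega, by omega⟩
    have hu := (h (N - k) hk').1 fun h => by omega
    rw [← Matrix.linearIndependent_rows_iff_isUnit] at hu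
    rw [hb.maxRank_eq_of_gt hd hex (by omega) h']
    have hle : m (N - k) ≤ m k := by
      have := hb.dim_le hd hex (k := N - k) (by omega) (by omega)
      rwa [Nat.sub_sub_self (by omega : k ≤ N)] at this
    let f : (Fin (m k) → ℝ) →ₗ[ℝ] (Fin (m (N - k)) → ℝ) :=
      -LinearMap.funLeft ℝ ℝ (Fin.castLE hle)
    have hf : (f ∘ fun j : Fin (m (N - k)) => pairingCol b ℓ k j) =
        (sqPairing b ℓ (N - k)).row := by
      refine funext fun j => funext fun i => ?_
      change -ℓ ⁅layerVec b k i, layerVec b (N - k) j⁆ =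
        ℓ ⁅layerVec b (N - k) j, layerVec b (N - (N - k)) i⁆
      rw [← map_neg, lie_skew, Nat.sub_sub_self (by omega : k ≤ N)]
    exact LinearIndependent.of_comp f (by rwa [hf])
  · have hk' : k ∈ Finset.Icc 1 (N / 2) := Finset.mem_Icc.2 ⟨by omega, by omega⟩
    by_cases ho : 2 * k = N ∧ Odd (m k)
    · rw [maxRank_of_odd ho]
      exact (firstRowsIndependent_iff ho.1).1 ((h k hk').2 ho).2
    · rw [hb.maxRank_eq_of_not_odd hd hex hk' ho]
      exact Matrix.linearIndependent_cols_iff_isUnit.2 ((h k hk').1 ho)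

theorem IsNondegenerate.rank_pairing (h : IsNondegenerate b ℓ) (hb : IsLayerAdapted b)
    (hd : 2 ≤ d ∨ N ≤ 2) (hex : ¬ (N = 3 ∧ d = 2)) (hk : k ∈ Finset.Icc 1 (N - 1)) (n : ℕ) :
    (pairing b ℓ k n).rank = min (maxRank N m k) n :=
  le_antisymm (rank_pairing_le b ℓ k n)
    (min_le_rank_pairing (h.linearIndependent_pairingCol hb hd hex hk) n)

theorem IsLayerAdapted.isNondegenerate_of_linearIndependent (hb : IsLayerAdapted b)
    (hd : 2 ≤ d ∨ N ≤ 2) (hex : ¬ (N = 3 ∧ d = 2))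
    (h : ∀ k ∈ Finset.Icc 1 (N / 2),
      LinearIndependent ℝ fun j : Fin (maxRank N m k) => pairingCol b ℓ k j) :
    IsNondegenerate b ℓ := by
  refine fun k hk => ⟨fun ho => ?_, fun ho => ?_⟩
  · have := h k hk
    rw [hb.maxRank_eq_of_not_odd hd hex hk ho] at this
    exact Matrix.linearIndependent_cols_iff_isUnit.1 this
  · have := h k hk
    rw [maxRank_of_odd ho] at this
    refine ⟨le_antisymm ?_ ?_, (firstRowsIndependent_iff ho.1).2 this⟩
    · exact Matrix.rank_le_of_transpose_eq_neg (sqPairing_transpose ho.1) ho.2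
    · exact (min_eq_left (Nat.sub_le _ _)).ge.trans (min_le_rank_pairing this (m k))

theorem IsLayerAdapted.isNondegenerate_of_le_rank (hb : IsLayerAdapted b)
    (hd : 2 ≤ d ∨ N ≤ 2) (hex : ¬ (N = 3 ∧ d = 2))
    (h : ∀ k ∈ Finset.Icc 1 (N / 2), ∀ n ∈ Finset.Icc 1 (m (N - k)),
      min (maxRank N m k) n ≤ (pairing b ℓ k n).rank) : IsNondegenerate b ℓ := by
  refine hb.isNondegenerate_of_linearIndependent hd hex fun k hk =>
    _root_.linearIndependent_pairingCol ?_
  have := Finset.mem_Icc.1 hk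
  -- The decisive choice is `n = maxRank N m k`; as `n` starts from `1`, rank zero is treated apart.
  rcases Nat.eq_zero_or_pos (maxRank N m k) with h0 | h0
  · omega
  · have := h k hk _ (Finset.mem_Icc.2 ⟨h0, maxRank_le_right (by omega)⟩)
    rwa [min_self] at this

/-- For each `k` the leading minor of size `maxRank N m k` is nonzero at some functional, hence all
are nonzero at a common one. In the middle layer this size is even, as needed for a skew matrix. -/
theorem IsLayerAdapted.exists_isNondegenerate (hb : IsLayerAdapted b)
    (hd : 2 ≤ d ∨ N ≤ 2) (hex : ¬ (N = 3 ∧ d = 2)) :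
    ∃ ℓ : Dual ℝ (FreeNilp N d), IsNondegenerate b ℓ := by
  have hdet : ∀ k ∈ Finset.Icc 1 (N / 2), ∃ ℓ : Dual ℝ (FreeNilp N d),
      (Matrix.of fun i j : Fin (maxRank N m k) =>
        ℓ ⁅layerVec b k i, layerVec b (N - k) j⁆).det ≠ 0 := by
    intro k hk
    obtain ⟨hk1, hkN⟩ := Finset.mem_Icc.1 hk
    have hvec : ∀ l ∈ Finset.Icc 1 N, maxRank N m k ≤ m l →
        LinearIndependent ℝ (fun i : Fin (maxRank N m k) => layerVec b l i) ∧
          ∀ i : Fin (maxRank N m k), layerVec b l i ∈ layer N d l := by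
      intro l hl hle
      have he : ∀ i : Fin (maxRank N m k),
          layerVec b l i = b (LayerIndex.mk l hl (Fin.castLE hle i)) :=
        fun i => layerVec_eq hl (i.2.trans_le hle)
      refine ⟨?_, fun i => ?_⟩
      · simp only [he]
        exact b.linearIndependent.comp (fun i => LayerIndex.mk l hl (Fin.castLE hle i))
          ((LayerIndex.mk_injective l hl).comp (Fin.castLE_injective hle))
      · rw [he]
        exact hb.mem_layer (LayerIndex.mk l hl (Fin.castLE hle i))
    obtain ⟨hx, hxk⟩ := hvec k (Finset.mem_Icc.2 ⟨hk1, by omega⟩) maxRank_le_left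
    rcases eq_or_ne (2 * k) N with h | h
    · rw [show N - k = k by omega]
      refine exists_dual_det_lie_self_ne_zero ?_ (by omega) hx hxk
      rw [maxRank, if_pos h]
      split_ifs with he
      · exact he
      · exact (Nat.not_even_iff_odd.1 he).tsub_odd odd_one
    · obtain ⟨hy, hyl⟩ := hvec (N - k) (Finset.mem_Icc.2 ⟨by omega, by omega⟩)
        (maxRank_le_right (by omega))
      exact exists_dual_det_lie_ne_zero (by omega) (by omega) hx hxk hy hyl
  obtain ⟨ℓ, hℓ⟩ := b.exists_dual_forall_det_ne_zero (Finset.Icc 1 (N / 2)) (maxRank N m)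
    (fun k i j => ⁅layerVec b k i, layerVec b (N - k) j⁆) hdet
  refine ⟨ℓ, hb.isNondegenerate_of_linearIndependent hd hex fun k hk => ?_⟩
  have hu : IsUnit (Matrix.of fun i j : Fin (maxRank N m k) =>
      ℓ ⁅layerVec b k i, layerVec b (N - k) j⁆) :=
    (Matrix.isUnit_iff_isUnit_det _).2 (hℓ k hk).isUnit
  rw [← Matrix.linearIndependent_cols_iff_isUnit] at hu
  exact LinearIndependent.of_comp
    (LinearMap.funLeft ℝ ℝ (Fin.castLE (maxRank_le_left (N := N) (m := m) (k := k)))) hu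

theorem IsLayerAdapted.pairingDim_eq (hb : IsLayerAdapted b)
    (hd : 2 ≤ d ∨ N ≤ 2) (hex : ¬ (N = 3 ∧ d = 2)) (hk : k ∈ Finset.Icc 1 (N - 1)) (n : ℕ) :
    pairingDim b k n = min (maxRank N m k) n := by
  obtain ⟨ℓ, hℓ⟩ := hb.exists_isNondegenerate hd hex
  refine IsGreatest.csSup_eq ⟨⟨ℓ, hℓ.rank_pairing hb hd hex hk n⟩, ?_⟩
  rintro _ ⟨ℓ', rfl⟩
  exact rank_pairing_le b ℓ' k n

end Ranks

end

/-! ### Dimensions of projected orbits -/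

noncomputable section

section OrbitDim

variable {N d : ℕ} {m : ℕ → ℕ} {b : Basis (LayerIndex N m) ℝ (FreeNilp N d)}
  {ℓ : Dual ℝ (FreeNilp N d)} {k : ℕ}

theorem IsNondegenerate.le_projOrbitDim (h : IsNondegenerate b ℓ) (hb : IsLayerAdapted b)
    (hd : 2 ≤ d ∨ N ≤ 2) (hex : ¬ (N = 3 ∧ d = 2)) (hk : k ∈ Finset.Icc 1 (N - 1))
    (j : LayerIndex N m) (hj : j.layer = N - k) :
    ((∑ s ∈ Finset.Icc 1 (k - 1), maxRank N m s + min (maxRank N m k) j.pos : ℕ) : ℝ≥0∞) ≤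
      projOrbitDim b ℓ j := by
  have hk' := Finset.mem_Icc.1 hk
  refine le_trans (le_of_eq ?_) (hb.le_projOrbitDim ℓ hk j hj)
  rw [h.rank_pairing hb hd hex hk]
  congr 2
  refine Finset.sum_congr rfl fun s hs => ?_
  have hs' := Finset.mem_Icc.1 hs
  rw [h.rank_pairing hb hd hex (Finset.mem_Icc.2 ⟨hs'.1, by omega⟩),
    min_eq_left (maxRank_le_right (by omega))]

/-- There are no free coordinates here, and the bound retains the rank of the given `ℓ`. This allows
ranks to be recovered from dimensions. -/
theorem IsLayerAdapted.projOrbitDim_le_of_two_mul_le (hb : IsLayerAdapted b)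
    (hd : 2 ≤ d ∨ N ≤ 2) (hex : ¬ (N = 3 ∧ d = 2)) (ℓ : Dual ℝ (FreeNilp N d))
    (hk : k ∈ Finset.Icc 1 (N - 1)) (hkN : 2 * k ≤ N) (j : LayerIndex N m)
    (hj : j.layer = N - k) :
    projOrbitDim b ℓ j ≤ ((∑ s ∈ Finset.Icc 1 (k - 1), maxRank N m s +
      (pairing b ℓ k j.pos).rank : ℕ) : ℝ≥0∞) := by
  refine (hb.projOrbitDim_le ℓ hk j (n := j.pos) fun i hi hil => ?_).trans (le_of_eq ?_)
  · rcases LayerIndex.le_iff.1 hi with h | h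
    · omega
    · exact h.2
  · rw [Finset.card_eq_zero.2, add_zero]
    · congr 2
      refine Finset.sum_congr rfl fun s hs => ?_
      have hs' := Finset.mem_Icc.1 hs
      exact (hb.maxRank_eq_of_lt hd hex hs'.1 (by omega)).symm
    · rw [Finset.filter_eq_empty_iff]
      rintro i - ⟨hi, hil⟩
      rcases LayerIndex.le_iff.1 hi with h | h <;> omega

theorem LayerIndex.card_filter_le (j : LayerIndex N m) {p : ℕ} (hp : p ≤ N + 1) :
    (Finset.univ.filter fun i : LayerIndex N m => i ≤ j ∧ i.layer < p).card ≤
      ∑ s ∈ Finset.Icc (j.layer + 1) (p - 1), m s + j.pos := by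
  classical
  have h1 : (Finset.univ.filter fun i : LayerIndex N m => i.layer = j.layer ∧ i.pos ≤ j.pos).card
      ≤ j.pos := by
    refine (Finset.card_le_card_of_injOn LayerIndex.pos (t := Finset.Icc 1 j.pos) ?_ ?_).trans_eq
      (by simp)
    · intro i hi
      exact Finset.mem_coe.2 (Finset.mem_Icc.2 ⟨i.one_le_pos, (Finset.mem_filter.1 hi).2.2⟩)
    · intro i hi i' hi' h
      have hl := (Finset.mem_filter.1 hi).2.1
      have hl' := (Finset.mem_filter.1 hi').2.1
      exact le_antisymm (LayerIndex.le_iff.2 (Or.inr ⟨hl.trans hl'.symm, h.le⟩))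
        (LayerIndex.le_iff.2 (Or.inr ⟨hl'.trans hl.symm, h.ge⟩))
  rw [← LayerIndex.card_layer_mem (N := N) (m := m)
    (Finset.Icc_subset_Icc (by omega) (by omega))]
  refine le_trans (Finset.card_le_card ?_) ((Finset.card_union_le _ _).trans
    (Nat.add_le_add_left h1 _))
  intro i hi
  obtain ⟨hij, hip⟩ := (Finset.mem_filter.1 hi).2
  simp only [Finset.mem_union, Finset.mem_filter, Finset.mem_univ, true_and, Finset.mem_Icc]
  rcases LayerIndex.le_iff.1 hij with h | h
  · left
    omega
  · exact Or.inr h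

/-- For `k > N/2` the parametrization stops at `h = N/2`; the pairings beyond have full column rank
in the count, so leaving their coordinates free loses nothing. -/
theorem IsLayerAdapted.projOrbitDim_le_sum_maxRank (hb : IsLayerAdapted b)
    (hd : 2 ≤ d ∨ N ≤ 2) (hex : ¬ (N = 3 ∧ d = 2)) (ℓ : Dual ℝ (FreeNilp N d))
    (hk : k ∈ Finset.Icc 1 (N - 1)) (j : LayerIndex N m) (hj : j.layer = N - k) :
    projOrbitDim b ℓ j ≤
      ((∑ s ∈ Finset.Icc 1 (k - 1), maxRank N m s + min (maxRank N m k) j.pos : ℕ) : ℝ≥0∞) := by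
  rcases Nat.lt_or_ge N (2 * k) with hkN | hkN
  · obtain ⟨hk1, hkN1⟩ := Finset.mem_Icc.1 hk
    obtain ⟨h, hh⟩ : ∃ h, h = N / 2 := ⟨_, rfl⟩
    have hhI : h ∈ Finset.Icc 1 (N - 1) := Finset.mem_Icc.2 ⟨by omega, by omega⟩
    refine (hb.projOrbitDim_le ℓ hhI j (n := m (N - h)) fun i _ hil =>
      hil ▸ i.pos_le).trans (Nat.cast_le.2 ?_)
    have h1 : ∑ s ∈ Finset.Icc 1 (h - 1), m s = ∑ s ∈ Finset.Icc 1 (h - 1), maxRank N m s :=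
      Finset.sum_congr rfl fun s hs => by
        have hs' := Finset.mem_Icc.1 hs
        exact (hb.maxRank_eq_of_lt hd hex hs'.1 (by omega)).symm
    have h2 := (rank_pairing_le b ℓ h (m (N - h))).trans (min_le_left _ _)
    have h3 := LayerIndex.card_filter_le j (p := N - h) (by omega)
    -- The reflection `s ↦ N - s` matches the free layers with the pairings beyond `h`.
    have h4 : ∑ s ∈ Finset.Icc (j.layer + 1) (N - h - 1), m s =
        ∑ s ∈ Finset.Icc (h + 1) (k - 1), maxRank N m s := by
      rw [hj]
      refine Finset.sum_nbij' (fun s => N - s) (fun s => N - s) ?_ ?_ ?_ ?_ ?_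
      all_goals
        intro s hs
        have hs' := Finset.mem_Icc.1 hs
      · exact Finset.mem_Icc.2 ⟨by omega, by omega⟩
      · exact Finset.mem_Icc.2 ⟨by omega, by omega⟩
      · omega
      · omega
      · rw [hb.maxRank_eq_of_gt hd hex (by omega) (by omega), Nat.sub_sub_self (by omega)]
    have h5 : min (maxRank N m k) j.pos = j.pos := by
      rw [hb.maxRank_eq_of_gt hd hex (by omega) hkN, ← hj, min_eq_right j.pos_le]
    have h6 : ∑ s ∈ Finset.Icc 1 (k - 1), maxRank N m s =
        ∑ s ∈ Finset.Icc 1 (h - 1), maxRank N m s + maxRank N m h +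
          ∑ s ∈ Finset.Icc (h + 1) (k - 1), maxRank N m s := by
      obtain ⟨h, rfl⟩ : ∃ l, h = l + 1 := ⟨h - 1, by omega⟩
      rw [Nat.add_sub_cancel, ← Finset.sum_Icc_succ_top (by omega)]
      simp only [← Finset.Ico_add_one_right_eq_Icc]
      exact (Finset.sum_Ico_consecutive _ (by omega) (by omega)).symm
    omega
  · exact (hb.projOrbitDim_le_of_two_mul_le hd hex ℓ hk hkN j hj).trans
      (Nat.cast_le.2 (Nat.add_le_add_left (rank_pairing_le b ℓ k j.pos) _))

/-- The last layer is central, so the projected orbit is a point. -/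
theorem IsLayerAdapted.projOrbitDim_eq_zero (hb : IsLayerAdapted b) (ℓ : Dual ℝ (FreeNilp N d))
    (j : LayerIndex N m) (hj : j.layer = N) : projOrbitDim b ℓ j = 0 := by
  rw [projOrbitDim, projOrbit_eq_range]
  refine Set.Subsingleton.dimH_zero ?_
  rintro _ ⟨X, rfl⟩ _ ⟨Y, rfl⟩
  refine funext fun i => ?_
  have hi : N ≤ (i : LayerIndex N m).layer := by
    rcases LayerIndex.le_iff.1 i.2 with h | h <;> omega
  exact congrArg ℓ (hb.adExp_eq (mem_deepLayers_one (X - Y)) (mem_deepLayers hi) (by omega))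

theorem IsNondegenerate.isInGeneralPosition (h : IsNondegenerate b ℓ) (hb : IsLayerAdapted b)
    (hd : 2 ≤ d ∨ N ≤ 2) (hex : ¬ (N = 3 ∧ d = 2)) : IsInGeneralPosition b ℓ := by
  intro j ℓ'
  have := j.one_le_layer
  rcases j.layer_le.eq_or_lt with hj | hj
  · rw [hb.projOrbitDim_eq_zero ℓ' j hj]
    exact zero_le
  · have hk : N - j.layer ∈ Finset.Icc 1 (N - 1) := Finset.mem_Icc.2 ⟨by omega, by omega⟩
    exact (hb.projOrbitDim_le_sum_maxRank hd hex ℓ' hk j (by omega)).trans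
      (h.le_projOrbitDim hb hd hex hk j (by omega))

/-- Compare with a nondegenerate functional at `k ≤ N/2`: its lower bound and the upper bound for
`ℓ` share the sum over `s < k`, which cancels and leaves an inequality of ranks. -/
theorem IsLayerAdapted.isNondegenerate_of_hasMaximalOrbitDim (hb : IsLayerAdapted b)
    (hd : 2 ≤ d ∨ N ≤ 2) (hex : ¬ (N = 3 ∧ d = 2))
    (h : ∀ k ∈ Finset.Icc 1 (N - 1), ∀ j : LayerIndex N m, j.layer = N - k →
      HasMaximalOrbitDim b ℓ j) : IsNondegenerate b ℓ := by
  obtain ⟨ℓ', hℓ'⟩ := hb.exists_isNondegenerate hd hex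
  refine hb.isNondegenerate_of_le_rank hd hex fun k hk n hn => ?_
  obtain ⟨hk1, hkN⟩ := Finset.mem_Icc.1 hk
  obtain ⟨hn1, hnm⟩ := Finset.mem_Icc.1 hn
  have hkI : k ∈ Finset.Icc 1 (N - 1) := Finset.mem_Icc.2 ⟨hk1, by omega⟩
  let j : LayerIndex N m := LayerIndex.mk (N - k) (Finset.mem_Icc.2 ⟨by omega, by omega⟩)
    ⟨n - 1, by omega⟩
  have hj : j.pos = n := Nat.sub_add_cancel hn1
  have hle := (hℓ'.le_projOrbitDim hb hd hex hkI j rfl).trans ((h k hkI j rfl ℓ').trans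
    (hb.projOrbitDim_le_of_two_mul_le hd hex ℓ hkI (by omega) j rfl))
  rw [hj, Nat.cast_le] at hle
  omega

theorem IsLayerAdapted.isNondegenerate_iff_sqPairing (hb : IsLayerAdapted b)
    (hd : 2 ≤ d ∨ N ≤ 2) (hex : ¬ (N = 3 ∧ d = 2)) :
    IsNondegenerate b ℓ ↔ ∀ k ∈ Finset.Icc 1 (N / 2),
      (∀ ℓ' : Dual ℝ (FreeNilp N d), (sqPairing b ℓ' k).rank ≤ (sqPairing b ℓ k).rank) ∧
      (2 * k = N ∧ Odd (m k) → FirstRowsIndependent b ℓ k) := by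
  have hI : ∀ k ∈ Finset.Icc 1 (N / 2), k ∈ Finset.Icc 1 (N - 1) := fun k hk => by
    have := Finset.mem_Icc.1 hk
    exact Finset.mem_Icc.2 ⟨by omega, by omega⟩
  constructor
  · intro h k hk
    refine ⟨fun ℓ' => ?_, fun ho => ((h k hk).2 ho).2⟩
    exact (rank_pairing_le b ℓ' k (m k)).trans_eq (h.rank_pairing hb hd hex (hI k hk) (m k)).symm
  · intro h
    obtain ⟨ℓ', hℓ'⟩ := hb.exists_isNondegenerate hd hex
    refine hb.isNondegenerate_of_linearIndependent hd hex fun k hk => ?_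
    by_cases ho : 2 * k = N ∧ Odd (m k)
    · rw [maxRank_of_odd ho]
      exact (firstRowsIndependent_iff ho.1).1 ((h k hk).2 ho)
    · have hr := ((hℓ'.rank_pairing hb hd hex (hI k hk) (m k)).symm.trans_le ((h k hk).1 ℓ'))
      rw [hb.maxRank_eq_of_not_odd hd hex hk ho, min_self] at hr
      rw [hb.maxRank_eq_of_not_odd hd hex hk ho]
      exact linearIndependent_pairingCol hr

end OrbitDim

end
-- The main theorem
theorem mainTheorem1 (N d : ℕ) (hN : 1 ≤ N) (hd : 2 ≤ d ∨ N ≤ 2) (hex : ¬ (N = 3 ∧ d = 2))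
    (m : ℕ → ℕ) (b : Module.Basis (LayerIndex N m) ℝ (FreeNilp N d))
    (hMalcev : IsStrongMalcev b) (hLayer : IsLayerAdapted b) :
    (∀ ℓ : Module.Dual ℝ (FreeNilp N d),
      List.TFAE [
        -- (i) `ℓ` is in general position
        IsInGeneralPosition b ℓ,
        -- (i) spelled out: maximal dimension at all indices `(N - k, n)`
        ∀ k ∈ Finset.Icc 1 (N - 1), ∀ j : LayerIndex N m, j.layer = N - k →
          HasMaximalOrbitDim b ℓ j,
        -- (ii) all `B_ℓ^k(n)` have maximal rank
        ∀ k ∈ Finset.Icc 1 (N - 1), ∀ n ∈ Finset.Icc 1 (m (N - k)),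
          ∀ ℓ' : Module.Dual ℝ (FreeNilp N d), (pairing b ℓ' k n).rank ≤ (pairing b ℓ k n).rank,
        -- (iii) all `B_ℓ^k` with `k ≤ N / 2` have maximal rank, attained in the first
        -- `m_k - 1` rows if `k = N / 2` and `m_k` is odd
        ∀ k ∈ Finset.Icc 1 (N / 2),
          (∀ ℓ' : Module.Dual ℝ (FreeNilp N d), (sqPairing b ℓ' k).rank ≤ (sqPairing b ℓ k).rank) ∧
          (2 * k = N ∧ Odd (m k) → FirstRowsIndependent b ℓ k),
        -- (iii) spelled out
        ∀ k ∈ Finset.Icc 1 (N / 2),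
          (¬ (2 * k = N ∧ Odd (m k)) → IsUnit (sqPairing b ℓ k)) ∧
          (2 * k = N ∧ Odd (m k) →
            (sqPairing b ℓ k).rank = m k - 1 ∧ FirstRowsIndependent b ℓ k)]) ∧
    -- the dimension formula
    (∀ ℓ : Module.Dual ℝ (FreeNilp N d), IsInGeneralPosition b ℓ →
      ∀ k ∈ Finset.Icc 1 (N - 1), ∀ j : LayerIndex N m, j.layer = N - k →
        projOrbitDim b ℓ j =
          (((∑ s ∈ Finset.Icc 1 (k - 1), pairingDim b s (m s)) + pairingDim b k j.pos : ℕ) : ENNReal)) ∧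
    -- the values of `dim(k, n)`
    (∀ k ∈ Finset.Icc 1 (N - 1), ∀ n : ℕ,
      pairingDim b k n =
        if 2 * k = N then (if Even (m k) then min (m k) n else min (m k - 1) n)
        else min (min (m k) (m (N - k))) n) := by
  have htfae : ∀ ℓ : Module.Dual ℝ (FreeNilp N d), List.TFAE [IsInGeneralPosition b ℓ,
      ∀ k ∈ Finset.Icc 1 (N - 1), ∀ j : LayerIndex N m, j.layer = N - k →
        HasMaximalOrbitDim b ℓ j,
      ∀ k ∈ Finset.Icc 1 (N - 1), ∀ n ∈ Finset.Icc 1 (m (N - k)),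
        ∀ ℓ' : Module.Dual ℝ (FreeNilp N d), (pairing b ℓ' k n).rank ≤ (pairing b ℓ k n).rank,
      ∀ k ∈ Finset.Icc 1 (N / 2),
        (∀ ℓ' : Module.Dual ℝ (FreeNilp N d), (sqPairing b ℓ' k).rank ≤ (sqPairing b ℓ k).rank) ∧
        (2 * k = N ∧ Odd (m k) → FirstRowsIndependent b ℓ k),
      IsNondegenerate b ℓ] := by
    intro ℓ
    -- All equivalences pass through nondegeneracy, the last item; a nondegenerate functional serves
    -- as the competitor in the converse directions.
    tfae_have 1 → 2 := fun h _ _ j _ => h j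
    tfae_have 2 → 5 := hLayer.isNondegenerate_of_hasMaximalOrbitDim hd hex
    tfae_have 5 → 1 := fun h => h.isInGeneralPosition hLayer hd hex
    tfae_have 5 → 3 := fun h k hk n _ ℓ' =>
      (rank_pairing_le b ℓ' k n).trans_eq (h.rank_pairing hLayer hd hex hk n).symm
    tfae_have 3 → 5 := by
      intro h
      obtain ⟨ℓ', hℓ'⟩ := hLayer.exists_isNondegenerate hd hex
      refine hLayer.isNondegenerate_of_le_rank hd hex fun k hk n hn => ?_
      have hk' := Finset.mem_Icc.1 hk
      have hkI : k ∈ Finset.Icc 1 (N - 1) := Finset.mem_Icc.2 ⟨hk'.1, by omega⟩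
      exact (hℓ'.rank_pairing hLayer hd hex hkI n).symm.trans_le (h k hkI n hn ℓ')
    tfae_have 5 ↔ 4 := hLayer.isNondegenerate_iff_sqPairing hd hex
    tfae_finish
  refine ⟨htfae, fun ℓ hℓ k hk j hj => ?_, fun k hk n => ?_⟩
  · have hreg : IsNondegenerate b ℓ := ((htfae ℓ).out 0 4).1 hℓ
    have hk' := Finset.mem_Icc.1 hk
    have hsum : ∑ s ∈ Finset.Icc 1 (k - 1), pairingDim b s (m s) =
        ∑ s ∈ Finset.Icc 1 (k - 1), maxRank N m s := Finset.sum_congr rfl fun s hs => by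
      have hs' := Finset.mem_Icc.1 hs
      rw [hLayer.pairingDim_eq hd hex (Finset.mem_Icc.2 ⟨hs'.1, by omega⟩),
        min_eq_left maxRank_le_left]
    rw [hsum, hLayer.pairingDim_eq hd hex hk]
    exact le_antisymm (hLayer.projOrbitDim_le_sum_maxRank hd hex ℓ hk j hj)
      (hreg.le_projOrbitDim hLayer hd hex hk j hj)
  · rw [hLayer.pairingDim_eq hd hex hk, maxRank]
    split_ifs <;> rfl
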